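/- **Theorem.** A cardinality minimization problem $\mathcal P$ is given by its instances, each consisting of an $n$-element ground set $\mathcal U$ (listed explicitly) and a description of constraints on the subsets of $\mathcal U$; the subsets satisfying the constraints are the feasible solutions, at least one exists, and $x_{opt}$ denotes a feasible solution of minimum size. For real numbers $0\le A<B\le 1$, $[A,B]$-Gap-$\mathcal P$ is the promise problem: given an instance of $\mathcal P$ such that $|x_{opt}|\le An$ or $|x_{opt}|\ge Bn$, decide whether $|x_{opt}|<Bn$. In online min-max-$\mathcal P$ an instance of $\mathcal P$ is fixed; in each round $t=1,2,\dots$ a randomized algorithm chooses a feasible solution $x^t$, then non-negative rational weights $w^t$ on $\mathcal U$ are revealed to it, and it pays $f^t(x^t)=\max_{u\in x^t}w^t(u)$ (which is $0$ if $x^t=\emptyset$). A randomized polynomial-time vanishing $\alpha$-regret algorithm is one for which (1) $x^t$ is computed in time polynomial in the length of the encoding of the instance and of the weights of the previous rounds; (2) there are a polynomial $p$ and a constant $0\le c<1$ such that, for every instance of encoding length $s$, every $T$, and every sequence of weights in $[0,1]$ fixed in advance (oblivious adversary), $$\mathbb E\Big[\sum_{t=1}^T f^t(x^t)\Big]-\alpha\min_{x\text{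 feasible}}\sum_{t=1}^T f^t(x)\le p(s)\,T^c .$$ Suppose that $[A,B]$-Gap-$\mathcal P$ is NP-complete (as a promise problem, under polynomial-time many-one reductions). Then, for every real $\alpha<B/A$ (for every real $\alpha$ if $A=0$), there is no randomized polynomial-time vanishing $\alpha$-regret algorithm for online min-max-$\mathcal P$ unless $\mathrm{NP}=\mathrm{RP}$. -/

import Mathlib

open scoped BigOperators NNRat

/-! ### Polynomial time, promise problems, NP and RP -/

/-- `f` is computable in polynomial time by a (multi-stack) Turing machine, when its inputs and
outputs are written as strings by means of `ea` and `eb`. -/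
def PolyTime {X Y Γ Δ : Type} (ea : X → List Γ) (eb : Y → List Δ) (f : X → Y) : Prop :=
  Nonempty (Turing.TM2ComputableInPolyTime ea eb f)

/-- The pair `(x, w)` of bit strings, written as `x # w`. -/
def encodePair (z : List Bool × List Bool) : List (Option Bool) :=
  z.1.map some ++ none :: z.2.map some

/-- A promise problem over bit strings: accept `yes`, reject `no`; anything may be answered on the
remaining strings. -/
structure PromiseProblem where
  yes : Set (List Bool)
  no : Set (List Bool)
  disjoint : Disjoint yes no

/-- A language, as the promise problem in which every string satisfies the promise. -/
def PromiseProblem.ofLanguage (L : Language Bool) : PromiseProblem where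
  yes := {x | x ∈ L}
  no := {x | x ∉ L}
  disjoint := Set.disjoint_left.2 fun _ hx hx' => hx' hx

/-- Membership in NP: there is a polynomial-time verifier, with certificates of polynomial
length. -/
def PromiseProblem.InNP (Q : PromiseProblem) : Prop :=
  ∃ (V : List Bool × List Bool → Bool) (p : Polynomial ℕ),
    PolyTime encodePair Computability.encodeBool V ∧
    (∀ x ∈ Q.yes, ∃ w : List Bool, w.length = p.eval x.length ∧ V (x, w) = true) ∧
    (∀ x ∈ Q.no, ∀ w : List Bool, w.length = p.eval x.length → V (x, w) = false)

/-- The probability that `V` accepts `x` together with `m` independent fair coin flips. -/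
noncomputable def acceptProb (V : List Bool × List Bool → Bool) (x : List Bool) (m : ℕ) : ℝ :=
  (Fintype.card {r : Fin m → Bool // V (x, List.ofFn r) = true} : ℝ) / 2 ^ m

/-- Membership in RP: there is a polynomial-time algorithm using polynomially many fair coin flips
that accepts yes-instances with probability at least `1/2` and never accepts a no-instance. -/
def PromiseProblem.InRP (Q : PromiseProblem) : Prop :=
  ∃ (V : List Bool × List Bool → Bool) (p : Polynomial ℕ),
    PolyTime encodePair Computability.encodeBool V ∧
    (∀ x ∈ Q.yes, 1 / 2 ≤ acceptProb V x (p.eval x.length)) ∧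
    (∀ x ∈ Q.no, acceptProb V x (p.eval x.length) = 0)

/-- The complexity class NP. -/
def classNP : Set (Language Bool) := {L | (PromiseProblem.ofLanguage L).InNP}

/-- The complexity class RP. -/
def classRP : Set (Language Bool) := {L | (PromiseProblem.ofLanguage L).InRP}

/-- Polynomial-time many-one (Karp) reducibility between promise problems. -/
def PromiseProblem.ReducesTo (Q R : PromiseProblem) : Prop :=
  ∃ f : List Bool → List Bool, PolyTime (id : List Bool → List Bool) id f ∧
    (∀ x ∈ Q.yes, f x ∈ R.yes) ∧ (∀ x ∈ Q.no, f x ∈ R.no)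

/-- NP-completeness of a promise problem, under polynomial-time many-one reductions. -/
def PromiseProblem.NPComplete (Q : PromiseProblem) : Prop :=
  Q.InNP ∧ ∀ L ∈ classNP, (PromiseProblem.ofLanguage L).ReducesTo Q

/-! ### Cardinality minimization problems and their gap versions -/

/-- The data of an instance: an `n`-element ground set, namely `Fin n`, and a description
`constraints` (a bit string) of the constraints on its subsets. -/
structure CardInstance where
  n : ℕ
  constraints : List Bool

/-- An instance as a bit string: the ground set is listed explicitly (`n` in unary), followed by
the constraints. -/
def CardInstance.encode (I : CardInstance) : List Bool :=
  List.replicate I.n true ++ false :: I.constraints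

/-- The size of an instance is the length of its encoding. -/
def CardInstance.size (I : CardInstance) : ℕ := I.encode.length

theorem CardInstance.encode_injective : Function.Injective CardInstance.encode := by
  rintro ⟨n, C⟩ ⟨m, D⟩ h
  simp only [CardInstance.encode] at h
  induction n generalizing m with
  | zero => cases m <;> simp_all [List.replicate_succ]
  | succ n ih =>
    cases m with
    | zero => simp [List.replicate_succ] at h
    | succ m =>
      simp only [List.replicate_succ, List.cons_append, List.cons.injEq, true_and] at h
      have := ih m h
      simp_all

/-- A cardinality minimization problem: which pairs (ground set, constraints) are instances, and
which subsets of the ground set are feasible. An instance has at least one feasible solution. -/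
structure CardMinProblem where
  IsInstance : CardInstance → Prop
  Feasible : (I : CardInstance) → Finset (Fin I.n) → Prop
  exists_feasible : ∀ I, IsInstance I → ∃ x, Feasible I x

/-- `|x_opt|`, the minimum size of a feasible solution. -/
noncomputable def CardMinProblem.opt (P : CardMinProblem) (I : CardInstance) : ℕ :=
  sInf (Finset.card '' {x | P.Feasible I x})

/-- The problem `[A,B]-Gap-P`: given an instance with `|x_opt| ≤ A n` or `|x_opt| ≥ B n`, decide
whether `|x_opt| < B n`. -/
noncomputable def CardMinProblem.gap (P : CardMinProblem) (A B : ℝ) : PromiseProblem where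
  yes := {s | ∃ I, P.IsInstance I ∧ I.encode = s ∧
    ((P.opt I : ℝ) ≤ A * I.n ∨ B * I.n ≤ (P.opt I : ℝ)) ∧ (P.opt I : ℝ) < B * I.n}
  no := {s | ∃ I, P.IsInstance I ∧ I.encode = s ∧
    ((P.opt I : ℝ) ≤ A * I.n ∨ B * I.n ≤ (P.opt I : ℝ)) ∧ ¬ (P.opt I : ℝ) < B * I.n}
  disjoint := by
    rw [Set.disjoint_left]
    rintro s ⟨I, -, hI, -, h⟩ ⟨J, -, hJ, -, h'⟩
    obtain rfl : I = J := CardInstance.encode_injective (hI.trans hJ.symm)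
    exact h' h

/-! ### Online min-max problems -/

/-- The min-max cost of `x` for the weights `w`: the largest weight of an element of `x`
(`0` if `x` is empty). -/
def minMaxCost {n : ℕ} (w : Fin n → ℚ≥0) (x : Finset (Fin n)) : ℚ≥0 := x.sup w

/-- The input alphabet of an online algorithm. -/
inductive RoundSymbol where
  | bit (b : Bool)
  | slash
  | comma
  | semicolon

/-- A weight as `numerator / denominator ,` in binary. -/
def encodeWeight (q : ℚ≥0) : List RoundSymbol :=
  q.num.bits.map .bit ++ .slash :: (q.den.bits.map .bit ++ [.comma])

/-- A weight vector: its entries one after the other, ended by a semicolon. -/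
def encodeWeights {n : ℕ} (w : Fin n → ℚ≥0) : List RoundSymbol :=
  (List.ofFn fun u => encodeWeight (w u)).flatten ++ [.semicolon]

/-- What an online algorithm may use in order to choose its action: the static instance, the weight
vectors of the earlier rounds (in chronological order), and coin flips. -/
structure RoundInput where
  inst : CardInstance
  history : List (Fin inst.n → ℚ≥0)
  coins : List Bool

/-- The encoding of the instance and of the earlier weight vectors. -/
def encodeHistory (I : CardInstance) (h : List (Fin I.n → ℚ≥0)) : List RoundSymbol :=
  I.encode.map .bit ++ .semicolon :: h.flatMap encodeWeights

def RoundInput.encode (i : RoundInput) : List RoundSymbol :=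
  encodeHistory i.inst i.history ++ i.coins.map .bit

/-- A subset of `Fin n` as the bit string of its characteristic vector. -/
def charVector {n : ℕ} (x : Finset (Fin n)) : List Bool :=
  List.ofFn fun u => decide (u ∈ x)

/-- A randomized online learning algorithm. Its randomness is a tape of fair coin flips which is
shared by all rounds; in each round it may read an initial segment of this tape, of length
polynomial in the length of the instance and of the history so far. -/
structure OnlineAlgorithm where
  coinBound : Polynomial ℕ
  act : (i : RoundInput) → Finset (Fin i.inst.n)

namespace OnlineAlgorithm

/-- The number of coin flips that may be read once the history is `h`. -/
noncomputable def numCoins (𝒪 : OnlineAlgorithm) (I : CardInstance)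
    (h : List (Fin I.n → ℚ≥0)) : ℕ :=
  𝒪.coinBound.eval (encodeHistory I h).length

/-- The action in round `t` (rounds are numbered from `0`) when the weights of the rounds are
`w 0, w 1, …` and the tape starts with the coin flips `ω`. -/
noncomputable def action (𝒪 : OnlineAlgorithm) (I : CardInstance) (w : ℕ → Fin I.n → ℚ≥0)
    (ω : List Bool) (t : ℕ) : Finset (Fin I.n) :=
  𝒪.act ⟨I, (List.range t).map w, ω.take (𝒪.numCoins I ((List.range t).map w))⟩

/-- The total cost of the first `T` rounds. -/
noncomputable def totalCost (𝒪 : OnlineAlgorithm) (I : CardInstance) (w : ℕ → Fin I.n → ℚ≥0)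
    (ω : List Bool) (T : ℕ) : ℝ :=
  ∑ t ∈ Finset.range T, (minMaxCost (w t) (𝒪.action I w ω t) : ℝ)

end OnlineAlgorithm

/-- The total cost over `T` rounds of the best static feasible solution in hindsight. -/
noncomputable def CardMinProblem.bestStatic (P : CardMinProblem) (I : CardInstance)
    (w : ℕ → Fin I.n → ℚ≥0) (T : ℕ) : ℝ :=
  sInf ((fun x => ∑ t ∈ Finset.range T, (minMaxCost (w t) x : ℝ)) '' {x | P.Feasible I x})

/-- The expected `α`-regret after `T` rounds against the fixed (oblivious) weights `w`. The
expectation is over uniformly random coin flips `ω`, at least as many as the first `T` rounds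
read. -/
noncomputable def OnlineAlgorithm.expectedRegret (𝒪 : OnlineAlgorithm) (P : CardMinProblem)
    (α : ℝ) (I : CardInstance) (w : ℕ → Fin I.n → ℚ≥0) (T : ℕ) : ℝ :=
  𝔼 ω : Fin (𝒪.numCoins I ((List.range T).map w)) → Bool,
    (𝒪.totalCost I w (List.ofFn ω) T - α * P.bestStatic I w T)

/-- `𝒪` is a randomized polynomial-time vanishing `α`-regret algorithm for online min-max-`P`:
* an action is computed in time polynomial in the length of the instance and of the history;
* every action is feasible;
* against any oblivious sequence of weights in `[0, 1]`, the expected `α`-regret after `T` rounds is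
  at most `p(size) * T ^ c` for some polynomial `p` and some constant `0 ≤ c < 1`. -/
structure OnlineAlgorithm.IsPolyTimeVanishing (𝒪 : OnlineAlgorithm) (P : CardMinProblem)
    (α : ℝ) : Prop where
  polyTime : PolyTime RoundInput.encode (id : List Bool → List Bool)
    (fun i => charVector (𝒪.act i))
  feasible : ∀ I, P.IsInstance I → ∀ (h : List (Fin I.n → ℚ≥0)) (ω : List Bool),
    ω.length = 𝒪.numCoins I h → P.Feasible I (𝒪.act ⟨I, h, ω⟩)
  regret : ∃ (p : Polynomial ℕ) (c : ℝ), 0 ≤ c ∧ c < 1 ∧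
    ∀ I, P.IsInstance I → ∀ w : ℕ → Fin I.n → ℚ≥0, (∀ t u, w t u ≤ 1) →
      ∀ T : ℕ, 𝒪.expectedRegret P α I w T ≤ ((p.eval I.size : ℕ) : ℝ) * (T : ℝ) ^ c

/-! A vanishing-regret algorithm puts every language `L` in NP into RP; the other inclusion holds
because an accepting sequence of coin flips is a certificate. Let the reduction map `x` to an
instance with `n` elements and fix a rational `q = a / b` strictly between `max α 0 * A` and `B`.
Draw 0/1 weights in which each entry is 1 independently with probability `p = 2^(-κ)`, feed them to
the algorithm, and look at its action in a uniformly random round among `T`. Accept if this action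
has fewer than `q * n` elements.

For a no-instance all feasible sets have at least `B * n ≥ q * n` elements, so acceptance never
happens (`acceptProb_verifier_eq_zero`). For a yes-instance some feasible set has `k ≤ A * n`
elements. A set of size `m` chosen before the weights of a round costs `1 - (1 - p)^m` in
expectation (`avg_minMaxCost`). As `n * p ≤ η` is small, this is almost linear in `m`: it is at most
`p * m`, and at least `q * n * p / (1 + η)` if `m ≥ q * n` (`le_one_sub_pow`). An action depends
only on earlier weights, which are independent of the current ones. The regret bound holds for each
fixed weight sequence and hence on average, so the expected number `S` of rounds with a large action
satisfies `q * n * p / (1 + η) * S ≤ max α 0 * T * p * k + R` (`sum_avg_large_le`). With `γ = max α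
0 * A / q < 1` and `T` polynomially large, so that the regret `R` is small against `T * p`
(`exists_rounds`), this yields `S ≤ (3 + γ) / 4 * T` (`le_of_regret`). The acceptance probability is
at least `(1 - γ) / 4` (`le_acceptProb_verifier`), and repetition raises it to `1 / 2`
(`inRP_of_acceptProb`).

The verifier must moreover run on a stack machine in polynomial time. Machines are assembled as
structured programs with loops and subroutine calls. This gives closure of `PolyMap` under
composition, pairing and length-bounded folds (`PolyMap.trans`, `PolyMap.pair`, `PolyMap.foldr`),
and everything after that is programming with folds (`polyTime_verifier`). -/

/-! ### Structured programs for stack machines -/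

namespace StackProgram

open Turing Function

/-! ### Runs of stack machines and the growth of their stacks -/

section Steps

variable {K : Type} [DecidableEq K] {Γ : K → Type} {Λ σ : Type}

/-- The machine `m` goes from `c` to `c'` in exactly `t` steps. -/
def Steps (m : Λ → TM2.Stmt Γ Λ σ) (t : ℕ) (c c' : TM2.Cfg Γ Λ σ) : Prop :=
  (flip bind (TM2.step m))^[t] (some c) = some c'

theorem Steps.refl (m : Λ → TM2.Stmt Γ Λ σ) (c : TM2.Cfg Γ Λ σ) : Steps m 0 c c := rfl

theorem Steps.trans {m : Λ → TM2.Stmt Γ Λ σ} {t u : ℕ} {c d e : TM2.Cfg Γ Λ σ}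
    (h : Steps m t c d) (h' : Steps m u d e) : Steps m (t + u) c e := by
  unfold Steps at *
  rw [add_comm, iterate_add_apply, h, h']

theorem iterate_bind_none (m : Λ → TM2.Stmt Γ Λ σ) (t : ℕ) :
    (flip bind (TM2.step m))^[t] (none : Option (TM2.Cfg Γ Λ σ)) = none := by
  induction t with
  | zero => rfl
  | succ t ih => rw [iterate_succ_apply]; exact ih

theorem steps_succ_some {m : Λ → TM2.Stmt Γ Λ σ} {t : ℕ} {l : Λ} {v : σ}
    {S : ∀ k, List (Γ k)} {e : TM2.Cfg Γ Λ σ} :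
    Steps m (t + 1) ⟨some l, v, S⟩ e ↔ Steps m t (TM2.stepAux (m l) v S) e := by
  unfold Steps
  rw [iterate_succ_apply]
  rfl

theorem steps_succ_none {m : Λ → TM2.Stmt Γ Λ σ} {t : ℕ} {v : σ}
    {S : ∀ k, List (Γ k)} {e : TM2.Cfg Γ Λ σ} : ¬ Steps m (t + 1) ⟨none, v, S⟩ e := by
  unfold Steps
  rw [iterate_succ_apply]
  show (flip bind (TM2.step m))^[t] none ≠ some e
  rw [iterate_bind_none]
  simp

/-- The number of symbols that a statement pushes at most. -/
def pushCount : TM2.Stmt Γ Λ σ → ℕ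
  | .push _ _ q => pushCount q + 1
  | .peek _ _ q => pushCount q
  | .pop _ _ q => pushCount q
  | .load _ q => pushCount q
  | .branch _ q₁ q₂ => pushCount q₁ + pushCount q₂
  | .goto _ => 0
  | .halt => 0

theorem length_stepAux_le (q : TM2.Stmt Γ Λ σ) (v : σ) (S : ∀ k, List (Γ k)) (k : K) :
    ((TM2.stepAux q v S).stk k).length ≤ (S k).length + pushCount q := by
  induction q generalizing v S with
  | push k' f q ih =>
    refine (ih _ _).trans ?_
    by_cases h : k = k'
    · subst h; simp [pushCount]; omega
    · simp [h, pushCount]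
  | peek k' f q ih => exact ih _ _
  | pop k' f q ih =>
    refine (ih _ _).trans ?_
    by_cases h : k = k'
    · subst h; simp [pushCount]
    · simp [h, pushCount]
  | load f q ih => exact ih _ _
  | branch f q₁ q₂ ih₁ ih₂ =>
    simp only [TM2.stepAux, pushCount]
    cases f v
    · exact (ih₂ _ _).trans (by omega)
    · exact (ih₁ _ _).trans (by omega)
  | goto f => simp [pushCount]
  | halt => simp [pushCount]

/-- Time bounds space. This will bound output lengths, without which running times could not be
composed. -/
theorem Steps.length_le {m : Λ → TM2.Stmt Γ Λ σ} {C : ℕ} (hC : ∀ l, pushCount (m l) ≤ C) {t : ℕ}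
    {c e : TM2.Cfg Γ Λ σ} (h : Steps m t c e) (k : K) :
    (e.stk k).length ≤ (c.stk k).length + C * t := by
  induction t generalizing c with
  | zero => cases h; simp
  | succ t ih =>
    obtain ⟨_ | l, v, S⟩ := c
    · exact absurd h steps_succ_none
    · refine (ih (steps_succ_some.1 h)).trans ?_
      have := length_stepAux_le (m l) v S k
      have := hC l
      simp only [Nat.mul_succ]
      omega

end Steps

/-! ### Embedding a machine in a larger one -/

section Lift

variable {K K' : Type} [DecidableEq K] [DecidableEq K'] {Γ' : K' → Type} {Λ Λ' σ σ' : Type}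

/-- Run a statement inside a larger machine, which has further stacks, further labels and further
state; instead of halting, go to `l₀` (or halt, if there is no `l₀`). -/
def lift (ι : K → K') (get : σ' → σ) (put : σ → σ' → σ') (g : Λ → Λ') (l₀ : Option Λ') :
    TM2.Stmt (fun k => Γ' (ι k)) Λ σ → TM2.Stmt Γ' Λ' σ'
  | .push k f q => .push (ι k) (fun s => f (get s)) (lift ι get put g l₀ q)
  | .peek k f q => .peek (ι k) (fun s o => put (f (get s) o) s) (lift ι get put g l₀ q)
  | .pop k f q => .pop (ι k) (fun s o => put (f (get s) o) s) (lift ι get put g l₀ q)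
  | .load f q => .load (fun s => put (f (get s)) s) (lift ι get put g l₀ q)
  | .branch f q₁ q₂ =>
    .branch (fun s => f (get s)) (lift ι get put g l₀ q₁) (lift ι get put g l₀ q₂)
  | .goto f => .goto fun s => g (f (get s))
  | .halt => match l₀ with
    | some l => .goto fun _ => l
    | none => .halt

/-- The label of the larger machine that corresponds to a label of the smaller one. -/
def liftLabel (g : Λ → Λ') (l₀ : Option Λ') : Option Λ → Option Λ'
  | some l => some (g l)
  | none => l₀

/-- The lens laws for `get` and `put` keep the embedded state faithful, and injectivity of `ι` keeps
the stacks apart, so the simulation is exact and foreign stacks are untouched. -/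
theorem stepAux_lift {ι : K → K'} (hι : Injective ι) {get : σ' → σ} {put : σ → σ' → σ'}
    (hget : ∀ v s, get (put v s) = v) (hput : ∀ v w s, put v (put w s) = put v s)
    (g : Λ → Λ') (l₀ : Option Λ') (q : TM2.Stmt (fun k => Γ' (ι k)) Λ σ) (v : σ)
    (v₀ : σ') (S : ∀ k, List (Γ' (ι k))) (S' : ∀ k, List (Γ' k)) (hS : ∀ k, S' (ι k) = S k) :
    (TM2.stepAux (lift ι get put g l₀ q) (put v v₀) S').l =
        liftLabel g l₀ (TM2.stepAux q v S).l ∧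
      (TM2.stepAux (lift ι get put g l₀ q) (put v v₀) S').var =
        put (TM2.stepAux q v S).var v₀ ∧
      (∀ k, (TM2.stepAux (lift ι get put g l₀ q) (put v v₀) S').stk (ι k) =
        (TM2.stepAux q v S).stk k) ∧
      ∀ k', (∀ k, ι k ≠ k') →
        (TM2.stepAux (lift ι get put g l₀ q) (put v v₀) S').stk k' = S' k' := by
  induction q generalizing v S S' with
  | push k f q ih =>
    obtain ⟨h₁, h₂, h₃, h₄⟩ := ih v (update S k (f v :: S k))
      (update S' (ι k) (f v :: S' (ι k))) (fun j => by
        by_cases h : j = k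
        · subst h; simp [hS]
        · rw [update_of_ne (hι.ne h), update_of_ne h, hS])
    simp only [lift, TM2.stepAux, hget]
    refine ⟨h₁, h₂, h₃, fun k' hk' => ?_⟩
    rw [h₄ k' hk', update_of_ne (hk' k).symm]
  | peek k f q ih =>
    simp only [lift, TM2.stepAux, hget, hput, hS]
    exact ih _ S S' hS
  | pop k f q ih =>
    obtain ⟨h₁, h₂, h₃, h₄⟩ := ih (f v (S k).head?) (update S k (S k).tail)
      (update S' (ι k) (S' (ι k)).tail) (fun j => by
        by_cases h : j = k
        · subst h; simp [hS]
        · rw [update_of_ne (hι.ne h), update_of_ne h, hS])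
    simp only [lift, TM2.stepAux, hget, hput]
    rw [hS] at h₁ h₂ h₃ h₄ ⊢
    refine ⟨h₁, h₂, h₃, fun k' hk' => ?_⟩
    rw [h₄ k' hk', update_of_ne (hk' k).symm]
  | load f q ih =>
    simp only [lift, TM2.stepAux, hget, hput]
    exact ih _ S S' hS
  | branch f q₁ q₂ ih₁ ih₂ =>
    simp only [lift, TM2.stepAux, hget]
    cases f v
    · exact ih₂ _ S S' hS
    · exact ih₁ _ S S' hS
  | goto f =>
    simp [lift, liftLabel, hget, hS]
  | halt =>
    cases l₀ <;> exact ⟨rfl, rfl, hS, fun _ _ => rfl⟩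

theorem Steps.lift {ι : K → K'} (hι : Injective ι) {get : σ' → σ} {put : σ → σ' → σ'}
    (hget : ∀ v s, get (put v s) = v) (hput : ∀ v w s, put v (put w s) = put v s)
    {m : Λ → TM2.Stmt (fun k => Γ' (ι k)) Λ σ} {m' : Λ' → TM2.Stmt Γ' Λ' σ'}
    {g : Λ → Λ'} {l₀ : Option Λ'} (hm : ∀ l, m' (g l) = StackProgram.lift ι get put g l₀ (m l))
    {t : ℕ} {l : Λ} {v w : σ} {S T : ∀ k, List (Γ' (ι k))}
    (h : Steps m t ⟨some l, v, S⟩ ⟨none, w, T⟩) (v₀ : σ') {S' T' : ∀ k, List (Γ' k)}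
    (hS : ∀ k, S' (ι k) = S k) (hT : ∀ k, T' (ι k) = T k)
    (hST : ∀ k', (∀ k, ι k ≠ k') → T' k' = S' k') :
    Steps m' t ⟨some (g l), put v v₀, S'⟩ ⟨l₀, put w v₀, T'⟩ := by
  induction t generalizing l v S S' with
  | zero => exact absurd h (by simp [Steps])
  | succ t ih =>
    rw [steps_succ_some] at h ⊢
    rw [hm]
    obtain ⟨h₁, h₂, h₃, h₄⟩ := stepAux_lift hι hget hput g l₀ (m l) v v₀ S S' hS
    generalize TM2.stepAux (StackProgram.lift ι get put g l₀ (m l)) (put v v₀) S' = c' at *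
    generalize TM2.stepAux (m l) v S = c at *
    obtain ⟨l₁, v₁, S₁⟩ := c
    obtain ⟨l₁', v₁', S₁'⟩ := c'
    simp only at h₁ h₂ h₃ h₄
    subst h₁ h₂
    cases l₁ with
    | none =>
      cases t with
      | zero =>
        simp only [Steps, iterate_zero, id_eq, Option.some.injEq, TM2.Cfg.mk.injEq, true_and] at h
        obtain ⟨rfl, rfl⟩ := h
        -- Each stack either belongs to the small machine or has never been touched.
        have : S₁' = T' := by
          funext k'
          by_cases hk : ∃ k, ι k = k'
          · obtain ⟨k, rfl⟩ := hk
            rw [h₃, hT]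
          · push Not at hk
            rw [h₄ _ hk, hST _ hk]
        subst this
        rfl
      | succ t => exact absurd h steps_succ_none
    | some l₁ => exact ih h h₃ fun k' hk' => (hST k' hk').trans (h₄ k' hk').symm

end Lift

/-! ### Programs: sequencing, loops and moving strings -/

/-- A program over the stacks `Γ` and the state space `σ`. -/
structure Prog {K : Type} (Γ : K → Type) (σ : Type) where
  Λ : Type
  [finite : Finite Λ]
  main : Λ
  m : Λ → TM2.Stmt Γ Λ σ

attribute [instance] Prog.finite

section

variable {K : Type} [DecidableEq K] {Γ : K → Type} {A ρ : Type} {r : ρ}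

/-- Started with the stacks `S`, the program halts with the stacks `S'` after at most `t` steps. Its
state is `(none, r)` before and after. -/
def Prog.Runs (r : ρ) (M : Prog Γ (Option A × ρ)) (S S' : ∀ k, List (Γ k)) (t : ℕ) : Prop :=
  ∃ u ≤ t, Steps M.m u ⟨some M.main, (none, r), S⟩ ⟨none, (none, r), S'⟩

theorem Prog.Runs.mono {M : Prog Γ (Option A × ρ)} {S S' : ∀ k, List (Γ k)} {t u : ℕ}
    (h : M.Runs r S S' t) (htu : t ≤ u) : M.Runs r S S' u :=
  let ⟨v, hv, h⟩ := h
  ⟨v, hv.trans htu, h⟩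

/-- The case of `Steps.lift` in which only the labels change; sequencing and loops need no more. -/
theorem Steps.transport {Λ Λ' σ : Type} {m : Λ → TM2.Stmt Γ Λ σ} {m' : Λ' → TM2.Stmt Γ Λ' σ}
    {g : Λ → Λ'} {l₀ : Option Λ'}
    (hm : ∀ l, m' (g l) = StackProgram.lift (Γ' := Γ) id id (fun v _ => v) g l₀ (m l))
    {t : ℕ} {l : Λ} {v w : σ} {S T : ∀ k, List (Γ k)}
    (h : Steps m t ⟨some l, v, S⟩ ⟨none, w, T⟩) :
    Steps m' t ⟨some (g l), v, S⟩ ⟨l₀, w, T⟩ :=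
  Steps.lift (ι := id) (Γ' := Γ) (get := id) (put := fun v _ => v) injective_id (fun _ _ => rfl)
    (fun _ _ _ => rfl) hm h v (fun _ => rfl) (fun _ => rfl) fun k' hk' => absurd rfl (hk' k')

/-- The program that pushes the string `l` on the stack `k`. -/
def pushStmt {Λ σ : Type} (k : K) : List (Γ k) → TM2.Stmt Γ Λ σ → TM2.Stmt Γ Λ σ
  | [], q => q
  | a :: l, q => pushStmt k l (.push k (fun _ => a) q)

theorem stepAux_pushStmt {Λ σ : Type} (k : K) (l : List (Γ k)) (q : TM2.Stmt Γ Λ σ) (v : σ)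
    (S : ∀ k, List (Γ k)) :
    TM2.stepAux (pushStmt k l q) v S = TM2.stepAux q v (update S k (l ++ S k)) := by
  induction l generalizing q with
  | nil => simp [pushStmt]
  | cons a l ih => simp [pushStmt, ih]

/-- Push the string `l` on the stack `k`. -/
def push (A ρ : Type) (k : K) (l : List (Γ k)) : Prog Γ (Option A × ρ) where
  Λ := Unit
  main := ()
  m _ := pushStmt k l .halt

theorem runs_push (k : K) (l : List (Γ k)) (S : ∀ k, List (Γ k)) :
    (push A ρ k l).Runs r S (update S k (l ++ S k)) 1 := by
  refine ⟨1, le_rfl, ?_⟩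
  rw [show (1 : ℕ) = 0 + 1 from rfl, steps_succ_some]
  simp only [push, stepAux_pushStmt]
  rfl

/-- One program after the other. -/
def seq (M N : Prog Γ (Option A × ρ)) : Prog Γ (Option A × ρ) where
  Λ := M.Λ ⊕ N.Λ
  main := .inl M.main
  m
    | .inl l => lift (Γ' := Γ) id id (fun v _ => v) .inl (some (.inr N.main)) (M.m l)
    | .inr l => lift (Γ' := Γ) id id (fun v _ => v) .inr none (N.m l)

theorem Prog.Runs.seq {M N : Prog Γ (Option A × ρ)} {S S' S'' : ∀ k, List (Γ k)} {t u : ℕ}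
    (h : M.Runs r S S' t) (h' : N.Runs r S' S'' u) :
    (StackProgram.seq M N).Runs r S S'' (t + u) := by
  obtain ⟨t', ht, h⟩ := h
  obtain ⟨u', hu, h'⟩ := h'
  exact ⟨t' + u', by omega, (Steps.transport (m' := (StackProgram.seq M N).m) (fun _ => rfl) h).trans
    (Steps.transport (m' := (StackProgram.seq M N).m) (fun _ => rfl) h')⟩

variable [Finite A]

/-- Pop the symbols of the stack `k` one after the other until it is empty; after popping `a` run
`body a`. The symbols are kept in the state by means of `e`. -/
noncomputable def loop (k : K) (e : Γ k → A) (body : Γ k → Prog Γ (Option A × ρ))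
    (he : Injective e) : Prog Γ (Option A × ρ) :=
  haveI : Finite (Γ k) := Finite.of_injective e he
  { Λ := Option (Σ a, Option (body a).Λ)
    main := none
    m := fun
      | none => .pop k (fun s o => (o.map e, s.2)) <| .branch (fun s => s.1.isSome)
          (.goto fun s => (s.1.bind (partialInv e)).map fun a => ⟨a, none⟩) .halt
      | some ⟨a, none⟩ => .load (fun s => (none, s.2)) <| .goto fun _ => some ⟨a, some (body a).main⟩
      | some ⟨a, some l⟩ =>
        lift (Γ' := Γ) id id (fun v _ => v) (fun l => some ⟨a, some l⟩) (some none) ((body a).m l) }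

variable {k : K} {e : Γ k → A} {body : Γ k → Prog Γ (Option A × ρ)} (he : Injective e)

theorem runs_loop_nil {S : ∀ k, List (Γ k)} (hS : S k = []) :
    (loop k e body he).Runs r S S 1 := by
  refine ⟨1, le_rfl, ?_⟩
  rw [show (1 : ℕ) = 0 + 1 from rfl, steps_succ_some]
  have : update S k [] = S := by rw [← hS, update_eq_self]
  simp [loop, hS, this, Steps.refl]

theorem runs_loop_cons {S S' S'' : ∀ k, List (Γ k)} {a : Γ k} {l : List (Γ k)} {t u : ℕ}
    (hS : S k = a :: l) (h : (body a).Runs r (update S k l) S' t)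
    (h' : (loop k e body he).Runs r S' S'' u) :
    (loop k e body he).Runs r S S'' (t + u + 2) := by
  obtain ⟨t', ht, h⟩ := h
  obtain ⟨u', hu, h'⟩ := h'
  -- The two extra steps pop the symbol into the register and clear the register before the body
  -- starts.
  refine ⟨(t' + u') + 1 + 1, by omega, ?_⟩
  rw [steps_succ_some]
  simp only [loop, TM2.stepAux, hS, List.head?_cons, Option.map_some, Option.isSome_some, cond_true,
    List.tail_cons, Option.bind_some, partialInv_left he]
  rw [steps_succ_some]
  simp only [TM2.stepAux]
  exact (Steps.transport (m' := (loop k e body he).m) (g := fun l => some ⟨a, some l⟩)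
    (l₀ := some none) (fun _ => rfl) h).trans h'

/-- Move the string on the stack `k` to the stack `k'`, reversing it and replacing `a` by `g a`. -/
noncomputable def move (ρ : Type) (k k' : K) (e : Γ k → A) (g : Γ k → List (Γ k'))
    (he : Injective e) : Prog Γ (Option A × ρ) :=
  loop k e (fun a => push A ρ k' (g a)) he

theorem runs_move {k' : K} (hk : k ≠ k') (g : Γ k → List (Γ k')) (S : ∀ k, List (Γ k)) :
    (move ρ k k' e g he).Runs r S
      (update (update S k []) k' ((S k).reverse.flatMap g ++ S k')) (3 * (S k).length + 1) := by
  generalize hl : S k = l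
  induction l generalizing S with
  | nil =>
    have : update (update S k []) k' (([] : List (Γ k)).reverse.flatMap g ++ S k') = S := by
      rw [← hl, update_eq_self]; simp [hl]
    rw [this]
    exact runs_loop_nil he hl
  | cons a l ih =>
    have h := ih (update (update S k l) k' (g a ++ (update S k l) k')) (by
      rw [update_of_ne hk, update_self])
    have h' := runs_loop_cons (body := fun a => push A ρ k' (g a)) he hl
      (runs_push (r := r) k' (g a) _) h
    refine cast (congrArg (fun T => (move ρ k k' e g he).Runs r S T _) ?_)
      (h'.mono (by simp; omega) : _)
    · funext j
      by_cases hj : j = k'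
      · subst hj; simp [hk.symm]
      · by_cases hj' : j = k
        · subst hj'; simp [hj]
        · simp [hj, hj']

end

/-! ### Calling a machine as a subroutine -/

section Call

variable {K : Type} [DecidableEq K] {Γ : K → Type} {A ρ : Type} {r : ρ}

/-- Run the machine `M`, whose stacks are some of ours, as a subroutine. -/
def call (A : Type) {K₀ Λ σ : Type} [Finite Λ] (ι : K₀ → K) (get : ρ → σ)
    (put : σ → ρ → ρ) (main : Λ) (m : Λ → TM2.Stmt (fun k => Γ (ι k)) Λ σ) :
    Prog Γ (Option A × ρ) where
  Λ := Λ
  main := main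
  m l := lift ι (fun s => get s.2) (fun v s => (s.1, put v s.2)) id none (m l)

/-- The subroutine ends in the state `v` in which it began, and by `hr` the host already stores `v`;
hence a call leaves the host's state intact and can be repeated. -/
theorem runs_call {K₀ Λ σ : Type} [DecidableEq K₀] [Finite Λ] {ι : K₀ → K} (hι : Injective ι)
    {get : ρ → σ} {put : σ → ρ → ρ} (hget : ∀ v s, get (put v s) = v)
    (hput : ∀ v w s, put v (put w s) = put v s) {main : Λ}
    {m : Λ → TM2.Stmt (fun k => Γ (ι k)) Λ σ} {v : σ} (hr : put v r = r)
    {S T : ∀ k, List (Γ (ι k))} {t : ℕ} (h : Steps m t ⟨some main, v, S⟩ ⟨none, v, T⟩)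
    {S' T' : ∀ k, List (Γ k)} (hS : ∀ k, S' (ι k) = S k) (hT : ∀ k, T' (ι k) = T k)
    (hST : ∀ k', (∀ k, ι k ≠ k') → T' k' = S' k') :
    (call A ι get put main m).Runs r S' T' t := by
  refine ⟨t, le_rfl, ?_⟩
  have := Steps.lift (get := fun s : Option A × ρ => get s.2)
    (put := fun v s => (s.1, put v s.2)) hι (fun _ _ => hget _ _)
    (fun _ _ _ => by simp [hput]) (m' := (call A ι get put main m).m) (g := id) (l₀ := none)
    (fun _ => rfl) h (none, r) hS hT hST
  rwa [hr] at this

end Call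

/-! ### Polynomial-time maps between encodings -/

/-- The string `v x` can be computed from the string `u x` in polynomial time. -/
def PolyMap {X Γ Δ : Type} (u : X → List Γ) (v : X → List Δ) : Prop :=
  PolyTime u v (id : X → X)

/-- A machine sees only strings, so the function can be absorbed into the output encoding. With both
encodings on one type `X`, several quantities derived from the same `x` can be combined freely. -/
theorem polyMap_of_polyTime {X Y Γ Δ : Type} {ea : X → List Γ} {eb : Y → List Δ} {f : X → Y}
    (h : PolyTime ea eb f) : PolyMap ea fun x => eb (f x) :=
  let ⟨h⟩ := h
  ⟨{ toTM2ComputableAux := h.toTM2ComputableAux, time := h.time, outputsFun := h.outputsFun }⟩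

theorem PolyMap.polyTime {X Y Γ Δ : Type} {ea : X → List Γ} {eb : Y → List Δ} {f : X → Y}
    (h : PolyMap ea fun x => eb (f x)) : PolyTime ea eb f :=
  let ⟨h⟩ := h
  ⟨{ toTM2ComputableAux := h.toTM2ComputableAux, time := h.time, outputsFun := h.outputsFun }⟩

theorem PolyMap.reindex {X Y Γ Δ : Type} {u : X → List Γ} {v : X → List Δ}
    (h : PolyMap u v) (g : Y → X) : PolyMap (fun y => u (g y)) fun y => v (g y) :=
  let ⟨h⟩ := h
  ⟨{ toTM2ComputableAux := h.toTM2ComputableAux, time := h.time,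
     outputsFun := fun y => h.outputsFun (g y) }⟩

theorem initList_stk (tm : FinTM2) (s : List (tm.Γ tm.k₀)) :
    (initList tm s).stk = update (fun _ => []) tm.k₀ s := by
  funext k
  by_cases h : k = tm.k₀
  · subst h; simp [initList]
  · simp [initList, h]

theorem haltList_stk (tm : FinTM2) (s : List (tm.Γ tm.k₁)) :
    (haltList tm s).stk = update (fun _ => []) tm.k₁ s := by
  funext k
  by_cases h : k = tm.k₁
  · subst h; simp [haltList]
  · simp [haltList, h]

section Of

variable {K : Type} [DecidableEq K] [Finite K] {Γ : K → Type} {A ρ : Type} [Finite A] [Finite ρ]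

/-- The machine that runs a program. -/
noncomputable def Prog.toFinTM2 (P : Prog Γ (Option A × ρ)) (r : ρ) (k₀ k₁ : K) [Finite (Γ k₀)] :
    FinTM2 :=
  haveI := Fintype.ofFinite K
  haveI := Fintype.ofFinite P.Λ
  haveI := Fintype.ofFinite (Option A × ρ)
  haveI := Fintype.ofFinite (Γ k₀)
  { K := K, k₀ := k₀, k₁ := k₁, Γ := Γ, Λ := P.Λ, main := P.main, σ := Option A × ρ,
    initialState := (none, r), m := P.m }

/-- The bridge from programs to Mathlib's machines, whose initial and final configurations have all
stacks empty except the input or output stack. -/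
theorem polyMap_of_runs {X Γ₀ Γ₁ : Type} [Finite Γ₀] {u : X → List Γ₀} {v : X → List Γ₁}
    (P : Prog Γ (Option A × ρ)) {r : ρ} {k₀ k₁ : K} (e₀ : Γ k₀ ≃ Γ₀) (e₁ : Γ k₁ ≃ Γ₁)
    (p : Polynomial ℕ)
    (h : ∀ x, P.Runs r (update (fun _ => []) k₀ ((u x).map e₀.symm))
      (update (fun _ => []) k₁ ((v x).map e₁.symm)) (p.eval (u x).length)) :
    PolyMap u v := by
  have : Finite (Γ k₀) := Finite.of_equiv _ e₀.symm
  choose t ht h using h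
  refine ⟨{ tm := P.toFinTM2 r k₀ k₁, inputAlphabet := e₀, outputAlphabet := e₁, time := p,
            outputsFun := fun x => ⟨⟨t x, ?_⟩, ht x⟩ }⟩
  have := h x
  unfold Steps at this
  refine Eq.trans ?_ (this.trans ?_)
  · congr 1
    have := initList_stk (P.toFinTM2 r k₀ k₁) ((u x).map e₀.symm)
    exact congrArg (fun S => some (⟨some P.main, (none, r), S⟩ : TM2.Cfg Γ P.Λ (Option A × ρ))) this
  · have := haltList_stk (P.toFinTM2 r k₀ k₁) ((v x).map e₁.symm)
    exact congrArg (fun S => some (⟨none, (none, r), S⟩ : TM2.Cfg Γ P.Λ (Option A × ρ))) this.symm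

end Of

/-- `tm` computes the string `v x` from the string `u x` within time `p`. -/
structure Computes {X Γ Δ : Type} (u : X → List Γ) (v : X → List Δ) (tm : FinTM2)
    (p : Polynomial ℕ) where
  ei : tm.Γ tm.k₀ ≃ Γ
  eo : tm.Γ tm.k₁ ≃ Δ
  steps : ∀ x, ∃ t ≤ p.eval (u x).length, Steps tm.m t
    ⟨some tm.main, tm.initialState, update (fun _ => []) tm.k₀ ((u x).map ei.symm)⟩
    ⟨none, tm.initialState, update (fun _ => []) tm.k₁ ((v x).map eo.symm)⟩

theorem PolyMap.exists_computes {X Γ Δ : Type} {u : X → List Γ} {v : X → List Δ}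
    (h : PolyMap u v) : ∃ tm p, Nonempty (Computes u v tm p) := by
  obtain ⟨h⟩ := h
  refine ⟨h.tm, h.time, ⟨⟨h.inputAlphabet, h.outputAlphabet, fun x => ?_⟩⟩⟩
  obtain ⟨⟨t, ht⟩, hle⟩ := h.outputsFun x
  refine ⟨t, hle, ?_⟩
  unfold Steps
  rw [← initList_stk, ← haltList_stk]
  exact ht

/-- A step pushes boundedly many symbols because there are finitely many labels, so a
polynomial-time machine has polynomially long output. -/
theorem PolyMap.exists_length_le {X Γ Δ : Type} {u : X → List Γ} {v : X → List Δ}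
    (h : PolyMap u v) : ∃ p : Polynomial ℕ, ∀ x, (v x).length ≤ p.eval (u x).length := by
  obtain ⟨tm, p, ⟨h⟩⟩ := h.exists_computes
  obtain ⟨C, hC⟩ : ∃ C, ∀ l, pushCount (tm.m l) ≤ C := by
    let := tm.ΛFin
    exact ⟨∑ l, pushCount (tm.m l), fun l =>
      Finset.single_le_sum (f := fun l => pushCount (tm.m l)) (fun _ _ => Nat.zero_le _)
        (Finset.mem_univ l)⟩
  refine ⟨.X + .C C * p, fun x => ?_⟩
  obtain ⟨t, ht, hs⟩ := h.steps x
  have := hs.length_le hC tm.k₁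
  simp only [update_self, List.length_map] at this
  refine this.trans ?_
  simp only [Polynomial.eval_add, Polynomial.eval_X, Polynomial.eval_mul, Polynomial.eval_C]
  refine add_le_add ?_ (Nat.mul_le_mul_left _ ht)
  -- If the output stack is also the input stack it starts with the input on it; this is the summand
  -- `X` of the bound.
  by_cases hk : tm.k₁ = tm.k₀
  · rw [hk]; simp
  · simp [hk]

section Pointwise

variable {K : Type} [DecidableEq K] {Γ : K → Type} {A ρ : Type} {r : ρ} {k k' : K}
  {S T U : ∀ k, List (Γ k)}

theorem eq_update_of {l : List (Γ k)} (h : T k = l) (h' : ∀ j, j ≠ k → T j = S j) :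
    update S k l = T := by
  funext j
  by_cases hj : j = k
  · subst hj; simp [h]
  · simp [hj, h']

theorem runs_push_of (l : List (Γ k)) (h : T k = l ++ S k) (h' : ∀ j, j ≠ k → T j = S j) :
    (push A ρ k l).Runs r S T 1 :=
  eq_update_of h h' ▸ runs_push k l S

variable [Finite A]

theorem runs_move_of {e : Γ k → A} (he : Injective e) (hk : k ≠ k') (g : Γ k → List (Γ k'))
    {l : List (Γ k)} (hS : S k = l) (h : T k = []) (h' : T k' = l.reverse.flatMap g ++ S k')
    (h'' : ∀ j, j ≠ k → j ≠ k' → T j = S j) :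
    (move ρ k k' e g he).Runs r S T (3 * l.length + 1) := by
  subst hS
  have := runs_move (r := r) he hk g S
  rwa [eq_update_of h'] at this
  intro j hj
  by_cases hj' : j = k
  · subst hj'; simp [h]
  · simp [hj', h'' j hj' hj]

theorem runs_loop_cons_of {e : Γ k → A} {body : Γ k → Prog Γ (Option A × ρ)} (he : Injective e)
    {a : Γ k} {l : List (Γ k)} {t u : ℕ} {S' : ∀ k, List (Γ k)} (hS : S k = a :: l) (h : T k = l)
    (h' : ∀ j, j ≠ k → T j = S j) (hb : (body a).Runs r T S' t)
    (hl : (loop k e body he).Runs r S' U u) : (loop k e body he).Runs r S U (t + u + 2) :=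
  runs_loop_cons he hS (by rwa [eq_update_of h h']) hl

/-- `S l c` is the loop invariant: `l` is what is left on the stack `k`, and the accumulator `c`
determines all other stacks. -/
theorem runs_loop_foldl {e : Γ k → A} {body : Γ k → Prog Γ (Option A × ρ)} (he : Injective e)
    {β : Type} (S : List (Γ k) → β → ∀ k, List (Γ k)) (g : β → Γ k → β) (t : ℕ)
    (hk : ∀ l c, S l c k = l) (hne : ∀ l l' c j, j ≠ k → S l c j = S l' c j)
    (hb : ∀ a l c, (body a).Runs r (S l c) (S l (g c a)) t) (l : List (Γ k)) (c : β) :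
    (loop k e body he).Runs r (S l c) (S [] (l.foldl g c)) (l.length * (t + 2) + 1) := by
  induction l generalizing c with
  | nil => exact (runs_loop_nil he (hk [] c)).mono (by simp)
  | cons a l ih =>
    refine (runs_loop_cons_of he (hk _ _) (hk l c) (hne _ _ c) (hb a l c) (ih (g c a))).mono ?_
    rw [List.length_cons, Nat.succ_mul]
    omega

end Pointwise

/-- Moving a string reverses it, so it is moved twice, with the substitution `g` made the second
time. Each move takes `3 * n + 1` steps and the final push of `c` takes one. -/
theorem polyMap_append_flatMap {X Γ Δ : Type} [Finite Γ] (u : X → List Γ) (c : List Δ)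
    (g : Γ → List Δ) : PolyMap u fun x => c ++ (u x).flatMap g := by
  let Γ' : Option Bool → Type := fun k => match k with
    | none => Γ
    | some false => Γ
    | some true => Δ
  let st (a b : List Γ) (d : List Δ) : ∀ k, List (Γ' k) := fun k => match k with
    | none => a
    | some false => b
    | some true => d
  have he : Injective (id : Γ → Γ) := injective_id
  let P₁ : Prog Γ' (Option Γ × Unit) :=
    move Unit (Γ := Γ') none (some false) (A := Γ) id (fun a => [a]) he
  let P₂ : Prog Γ' (Option Γ × Unit) :=
    move Unit (Γ := Γ') (some false) (some true) (A := Γ) id g he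
  let P₃ : Prog Γ' (Option Γ × Unit) := push Γ Unit (Γ := Γ') (some true) c
  refine polyMap_of_runs (seq (seq P₁ P₂) P₃) (r := ()) (k₀ := none) (k₁ := some true)
    (Equiv.refl Γ) (Equiv.refl Δ) (6 * .X + 3) fun x => ?_
  have h₁ : P₁.Runs () (st (u x) [] []) (st [] (u x).reverse []) (3 * (u x).length + 1) :=
    runs_move_of (Γ := Γ') he (by simp) _ rfl rfl (by simp [st])
      (by rintro (_ | _ | _) <;> simp [st])
  have h₂ : P₂.Runs () (st [] (u x).reverse []) (st [] [] ((u x).flatMap g))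
      (3 * (u x).reverse.length + 1) :=
    runs_move_of (Γ := Γ') he (by simp) _ rfl rfl (by simp [st])
      (by rintro (_ | _ | _) <;> simp [st])
  have h₃ : P₃.Runs () (st [] [] ((u x).flatMap g)) (st [] [] (c ++ (u x).flatMap g)) 1 :=
    runs_push_of (Γ := Γ') (k := some true) (S := st [] [] ((u x).flatMap g))
      (T := st [] [] (c ++ (u x).flatMap g)) c rfl (by rintro (_ | _ | _) <;> simp [st])
  have h := (h₁.seq h₂).seq h₃
  rw [← eq_update_of (Γ := Γ') (S := fun _ => []) (k := none) (T := st (u x) [] []) rfl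
      (by rintro (_ | _ | _) <;> simp [st]),
    ← eq_update_of (Γ := Γ') (S := fun _ => []) (k := some true)
      (T := st [] [] (c ++ (u x).flatMap g)) rfl (by rintro (_ | _ | _) <;> simp [st])] at h
  convert h.mono (u := (6 * .X + 3 : Polynomial ℕ).eval (u x).length) ?_ using 3
  · exact List.map_id _
  · exact List.map_id _
  · simp; omega

/-! ### Programs with several subroutines -/

section Host

variable {V ι : Type} (ΓV : V → Type) (M : ι → FinTM2)

/-- The stacks of a program which has the stacks `ΓV` and those of the subroutines `M`. -/
abbrev hostΓ : V ⊕ (Σ i, (M i).K) → Type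
  | .inl v => ΓV v
  | .inr p => (M p.1).Γ p.2

variable {ΓV M}

/-- The contents of all the stacks. -/
def hostStk (a : ∀ v, List (ΓV v)) (b : ∀ i k, List ((M i).Γ k)) : ∀ k, List (hostΓ ΓV M k)
  | .inl v => a v
  | .inr p => b p.1 p.2

/-- All stacks of the subroutines are empty, except for the stack `k` of the subroutine `i`. -/
def single [DecidableEq ι] (i : ι) (k : (M i).K) (l : List ((M i).Γ k)) :
    ∀ i k, List ((M i).Γ k) :=
  update (fun _ _ => []) i (update (fun _ => []) k l)

variable [DecidableEq ι]

theorem single_nil (i : ι) (k : (M i).K) : single i k ([] : List ((M i).Γ k)) = fun _ _ => [] := by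
  simp [single]

theorem single_self (i : ι) (k : (M i).K) (l : List ((M i).Γ k)) : single i k l i k = l := by
  simp [single]

theorem hostStk_single_of_ne (a : ∀ v, List (ΓV v)) (i : ι) (k : (M i).K) (l l' : List ((M i).Γ k))
    (j : V ⊕ (Σ i, (M i).K)) (hj : j ≠ .inr ⟨i, k⟩) :
    hostStk a (single i k l) j = hostStk a (single i k l') j := by
  obtain v | ⟨i', k'⟩ := j
  · rfl
  · by_cases hi : i' = i
    · subst hi
      have : k' ≠ k := by rintro rfl; exact hj rfl
      simp [hostStk, single, this]
    · simp [hostStk, single, hi]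

variable [DecidableEq V]

/-- Run the subroutine `i`. -/
def callSub (ΓV : V → Type) (A : Type) (M : ι → FinTM2) (i : ι) :
    Prog (hostΓ ΓV M) (Option A × ∀ i, (M i).σ) :=
  haveI : Finite (M i).Λ := (M i).ΛFin.finite
  call A (Γ := hostΓ ΓV M) (fun k => .inr ⟨i, k⟩) (fun s => s i) (fun v s => update s i v)
    (M i).main (M i).m

/-- The host's state consists of the initial states of all subroutines, and a halting subroutine is
back in its initial state. -/
theorem Computes.runs {X : Type} {Γ Δ : Type} {A : Type} {i : ι}
    {u : X → List Γ} {v : X → List Δ} {p : Polynomial ℕ}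
    (h : Computes u v (M i) p) (x : X) (a : ∀ v, List (ΓV v)) :
    (callSub ΓV A M i).Runs (fun i => (M i).initialState)
      (hostStk a (single i (M i).k₀ ((u x).map h.ei.symm)))
      (hostStk a (single i (M i).k₁ ((v x).map h.eo.symm))) (p.eval (u x).length) := by
  obtain ⟨t, ht, hs⟩ := h.steps x
  have : Finite (M i).Λ := (M i).ΛFin.finite
  refine Prog.Runs.mono (runs_call (Γ := hostΓ ΓV M) (ι := fun k => .inr ⟨i, k⟩) ?_ ?_ ?_ ?_ hs
    ?_ ?_ ?_) ht
  · intro k k' h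
    simpa using h
  · simp
  · simp
  · simp
  · intro k; simp [hostStk, single]
  · intro k; simp [hostStk, single]
  · rintro (v | ⟨i', k'⟩) hk
    · rfl
    · have : i' ≠ i := by rintro rfl; exact hk k' rfl
      simp [hostStk, single, this]

theorem update_nil_inr (i : ι) (k : (M i).K) (l : List ((M i).Γ k)) :
    (update (fun _ => []) (Sum.inr ⟨i, k⟩) l : ∀ j, List (hostΓ ΓV M j)) =
      hostStk (fun _ => []) (single i k l) := by
  refine eq_update_of (Γ := hostΓ ΓV M) (single_self ..) ?_
  rintro (_ | j) h
  · rfl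
  · rw [hostStk_single_of_ne (ΓV := ΓV) (fun _ => []) i k l [] _ h, single_nil]; rfl

theorem update_nil_inl {v : V} {l : List (ΓV v)} {a : ∀ v, List (ΓV v)} (h : a v = l)
    (h' : ∀ w, w ≠ v → a w = []) :
    (update (fun _ => []) (Sum.inl v) l : ∀ j, List (hostΓ ΓV M j)) =
      hostStk a (fun _ _ => []) := by
  refine eq_update_of (Γ := hostΓ ΓV M) h ?_
  rintro (w | j) hj
  · exact h' w (by simpa using hj)
  · rfl

variable {A : Type} [Finite A] {r : ∀ i, (M i).σ} {a a' : ∀ v, List (ΓV v)}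

theorem flatMap_singleton_eq_map {α β : Type} (g : α → β) (l : List α) :
    l.flatMap (fun a => [g a]) = l.map g := by
  induction l <;> simp_all

/-- Move a string between two stacks that do not belong to a subroutine. -/
theorem runs_transfer {v w : V} {e : ΓV v → A} (he : Injective e) (hv : v ≠ w) (g : ΓV v → ΓV w)
    {l : List (ΓV v)} (h₁ : a v = l) (h₂ : a' v = []) (h₃ : a' w = l.reverse.map g ++ a w)
    (h₄ : ∀ j, j ≠ v → j ≠ w → a' j = a j) (b : ∀ i k, List ((M i).Γ k)) :
    (move (Γ := hostΓ ΓV M) _ (.inl v) (.inl w) e (fun a => [g a]) he).Runs r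
      (hostStk a b) (hostStk a' b) (3 * l.length + 1) := by
  refine runs_move_of (Γ := hostΓ ΓV M) he (by simpa using hv) _ h₁ h₂ ?_ ?_
  · rw [flatMap_singleton_eq_map]; exact h₃
  · rintro (j | j) h h'
    · exact h₄ j (by simpa using h) (by simpa using h')
    · rfl

/-- Move a string to a stack of a subroutine. -/
theorem runs_load {v : V} {i : ι} {k : (M i).K} {e : ΓV v → A} (he : Injective e)
    (g : ΓV v → (M i).Γ k) {l : List (ΓV v)} (h₁ : a v = l) (h₂ : a' v = [])
    (h₃ : ∀ j, j ≠ v → a' j = a j) :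
    (move (Γ := hostΓ ΓV M) _ (.inl v) (.inr ⟨i, k⟩) e (fun a => [g a]) he).Runs r
      (hostStk a (fun _ _ => [])) (hostStk a' (single i k (l.reverse.map g)))
      (3 * l.length + 1) := by
  refine runs_move_of (Γ := hostΓ ΓV M) he (by simp) _ h₁ h₂ ?_ ?_
  · rw [flatMap_singleton_eq_map]
    exact (single_self ..).trans (List.append_nil _).symm
  · rintro (j | j) h h'
    · exact h₃ j (by simpa using h)
    · rw [hostStk_single_of_ne a' i k _ [] _ h', single_nil]; rfl

/-- Move a string from a stack of a subroutine. -/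
theorem runs_unload {w : V} {i : ι} {k : (M i).K} {e : (M i).Γ k → A} (he : Injective e)
    (g : (M i).Γ k → ΓV w) {l : List ((M i).Γ k)} (h₁ : a' w = l.reverse.map g ++ a w)
    (h₂ : ∀ j, j ≠ w → a' j = a j) :
    (move (Γ := hostΓ ΓV M) _ (.inr ⟨i, k⟩) (.inl w) e (fun a => [g a]) he).Runs r
      (hostStk a (single i k l)) (hostStk a' (fun _ _ => [])) (3 * l.length + 1) := by
  refine runs_move_of (Γ := hostΓ ΓV M) he (by simp) _ (single_self ..) rfl ?_ ?_
  · rw [flatMap_singleton_eq_map]; exact h₁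
  · rintro (j | j) h h'
    · exact h₂ j (by simpa using h')
    · rw [hostStk_single_of_ne a i k _ [] _ h, single_nil]; rfl

end Host

/-! ### Composition, pairing and iteration of polynomial-time maps -/

theorem eval_mono (p : Polynomial ℕ) {a b : ℕ} (h : a ≤ b) : p.eval a ≤ p.eval b := by
  induction p using Polynomial.induction_on' with
  | add p q hp hq => simpa using add_le_add hp hq
  | monomial n c => simpa using Nat.mul_le_mul_left c (Nat.pow_le_pow_left h n)

/-- The intermediate string is carried through a stack of the host, where it lies reversed; loading
it into the second machine restores the order. Its length is at most `q`, hence the term `p₂.comp q`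
in the time bound. -/
theorem PolyMap.trans {X Γ Δ Θ : Type} [Finite Γ] [Finite Δ] {u : X → List Γ} {v : X → List Δ}
    {w : X → List Θ} (h₁ : PolyMap u v) (h₂ : PolyMap v w) : PolyMap u w := by
  obtain ⟨q, hq⟩ := h₁.exists_length_le
  obtain ⟨tm₁, p₁, h₁⟩ := h₁.exists_computes
  obtain ⟨tm₂, p₂, h₂⟩ := h₂.exists_computes
  obtain ⟨M, ⟨h₁⟩, ⟨h₂⟩⟩ : ∃ M : Bool → FinTM2, Nonempty (Computes u v (M true) p₁) ∧
      Nonempty (Computes v w (M false) p₂) := ⟨fun b => cond b tm₁ tm₂, h₁, h₂⟩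
  let ΓV : Unit → Type := fun _ => Δ
  let P₁ := callSub ΓV Δ M true
  let P₂ : Prog (hostΓ ΓV M) (Option Δ × ∀ i, (M i).σ) :=
    move _ (.inr ⟨true, (M true).k₁⟩) (.inl ()) (A := Δ) h₁.eo (fun a => [h₁.eo a])
      h₁.eo.injective
  let P₃ : Prog (hostΓ ΓV M) (Option Δ × ∀ i, (M i).σ) :=
    move _ (.inl ()) (.inr ⟨false, (M false).k₀⟩) (A := Δ) id (fun a => [h₂.ei.symm a])
      injective_id
  let P₄ := callSub ΓV Δ M false
  have : ∀ i, Finite (M i).σ := fun i => (M i).σFin.finite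
  have : ∀ i, Finite (M i).K := fun i => (M i).kFin.finite
  refine polyMap_of_runs (seq (seq (seq P₁ P₂) P₃) P₄) (r := fun i => (M i).initialState)
    (k₀ := .inr ⟨true, (M true).k₀⟩) (k₁ := .inr ⟨false, (M false).k₁⟩) h₁.ei h₂.eo
    (p₁ + (6 * q + 2) + p₂.comp q) fun x => ?_
  have r₁ := h₁.runs (A := Δ) x (ΓV := ΓV) (fun _ => [])
  have r₂ : P₂.Runs (fun i => (M i).initialState) _ _ _ :=
    runs_unload (ΓV := ΓV) (a := fun _ => []) (a' := fun _ => (v x).reverse)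
      (l := (v x).map h₁.eo.symm) h₁.eo.injective h₁.eo (by simp) (by simp)
  have r₃ : P₃.Runs (fun i => (M i).initialState) _ _ _ :=
    runs_load (ΓV := ΓV) (a := fun _ => (v x).reverse) (a' := fun _ => []) injective_id h₂.ei.symm
      rfl rfl (by simp)
  rw [List.reverse_reverse] at r₃
  have r₄ := h₂.runs (A := Δ) x (ΓV := ΓV) (fun _ => [])
  rw [update_nil_inr, update_nil_inr]
  refine (((r₁.seq r₂).seq r₃).seq r₄).mono ?_
  have := hq x
  have := eval_mono p₂ this
  simp
  omega

/-- A pair of strings as a string. -/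
def pairStr {Γ Δ : Type} (u : List Γ) (v : List Δ) : List (Option (Γ ⊕ Δ)) :=
  u.map (fun a => some (.inl a)) ++ none :: v.map fun a => some (.inr a)

theorem length_pairStr {Γ Δ : Type} (u : List Γ) (v : List Δ) :
    (pairStr u v).length = u.length + v.length + 1 := by
  simp [pairStr]; omega

-- The first machine consumes its input, so the input is duplicated beforehand. The two outputs are
-- kept on separate stacks and joined at the end, the second one first because a stack is filled
-- from the bottom.
set_option maxHeartbeats 400000 in
theorem PolyMap.pair {X Γ Δ Θ : Type} [Finite Γ] [Finite Δ] [Finite Θ] {u : X → List Γ}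
    {v : X → List Δ} {w : X → List Θ} (h₁ : PolyMap u v) (h₂ : PolyMap u w) :
    PolyMap u fun x => pairStr (v x) (w x) := by
  obtain ⟨q₁, hq₁⟩ := h₁.exists_length_le
  obtain ⟨q₂, hq₂⟩ := h₂.exists_length_le
  obtain ⟨tm₁, p₁, h₁⟩ := h₁.exists_computes
  obtain ⟨tm₂, p₂, h₂⟩ := h₂.exists_computes
  obtain ⟨M, ⟨h₁⟩, ⟨h₂⟩⟩ : ∃ M : Bool → FinTM2, Nonempty (Computes u v (M true) p₁) ∧
      Nonempty (Computes u w (M false) p₂) := ⟨fun b => cond b tm₁ tm₂, h₁, h₂⟩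
  let A := Γ ⊕ Δ ⊕ Θ
  let ΓV : Option Bool ⊕ Option Bool → Type := fun k => match k with
    | .inl _ => Γ
    | .inr (some true) => Δ
    | .inr (some false) => Θ
    | .inr none => Option (Δ ⊕ Θ)
  let st (i c₁ c₂ : List Γ) (o₁ : List Δ) (o₂ : List Θ) (o : List (Option (Δ ⊕ Θ))) :
      ∀ k, List (ΓV k) := fun k => match k with
    | .inl none => i
    | .inl (some true) => c₁
    | .inl (some false) => c₂
    | .inr (some true) => o₁
    | .inr (some false) => o₂
    | .inr none => o
  let ρ := ∀ i, (M i).σ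
  let r : ρ := fun i => (M i).initialState
  have eΓ : Injective (Sum.inl : Γ → A) := Sum.inl_injective
  have eΔ : Injective (fun a : Δ => (.inr (.inl a) : A)) := fun a b h => by simpa using h
  have eΘ : Injective (fun a : Θ => (.inr (.inr a) : A)) := fun a b h => by simpa using h
  let dup : Prog (hostΓ ΓV M) (Option A × ρ) := loop (Γ := hostΓ ΓV M) (.inl (.inl none)) (A := A)
    Sum.inl (fun a => seq (push (Γ := hostΓ ΓV M) A ρ (.inl (.inl (some true))) [a])
      (push (Γ := hostΓ ΓV M) A ρ (.inl (.inl (some false))) [a])) eΓ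
  have r₁ (l : List Γ) : dup.Runs r (hostStk (st l [] [] [] [] []) fun _ _ => [])
      (hostStk (st [] l.reverse l.reverse [] [] []) fun _ _ => [])
      (l.length * (1 + 1 + 2) + 1) := by
    have := runs_loop_foldl (Γ := hostΓ ΓV M) (r := r) (k := .inl (.inl none)) eΓ
      (body := fun a => seq (push (Γ := hostΓ ΓV M) A ρ (.inl (.inl (some true))) [a])
        (push (Γ := hostΓ ΓV M) A ρ (.inl (.inl (some false))) [a]))
      (fun l (c : List Γ) => hostStk (st l c c [] [] []) fun _ _ => []) (fun c a => a :: c) (1 + 1)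
      (fun _ _ => rfl) (by
        rintro l l' c (((_ | _ | _) | _ | _ | _) | _) h <;> first | rfl | exact absurd rfl h)
      (fun a l c => Prog.Runs.seq (S' := hostStk (st l (a :: c) c [] [] []) fun _ _ => [])
        (runs_push_of (Γ := hostΓ ΓV M) (k := .inl (.inl (some true)))
          (S := hostStk (st l c c [] [] []) fun _ _ => [])
          (T := hostStk (st l (a :: c) c [] [] []) fun _ _ => []) [a] rfl
          (by rintro (((_ | _ | _) | _ | _ | _) | _) h <;> first | rfl | exact absurd rfl h))
        (runs_push_of (Γ := hostΓ ΓV M) (k := .inl (.inl (some false)))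
          (S := hostStk (st l (a :: c) c [] [] []) fun _ _ => [])
          (T := hostStk (st l (a :: c) (a :: c) [] [] []) fun _ _ => []) [a] rfl
          (by rintro (((_ | _ | _) | _ | _ | _) | _) h <;> first | rfl | exact absurd rfl h))) l []
    rwa [show l.foldl (fun c a => a :: c) [] = l.reverse by simp] at this
  let Q₂ : Prog (hostΓ ΓV M) (Option A × ρ) := move _ (.inl (.inl (some true)))
    (.inr ⟨true, (M true).k₀⟩) (A := A) Sum.inl (fun a => [h₁.ei.symm a]) eΓ
  let Q₄ : Prog (hostΓ ΓV M) (Option A × ρ) := move _ (.inr ⟨true, (M true).k₁⟩)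
    (.inl (.inr (some true))) (A := A) (fun a => .inr (.inl (h₁.eo a))) (fun a => [h₁.eo a])
    (eΔ.comp h₁.eo.injective)
  let Q₅ : Prog (hostΓ ΓV M) (Option A × ρ) := move _ (.inl (.inl (some false)))
    (.inr ⟨false, (M false).k₀⟩) (A := A) Sum.inl (fun a => [h₂.ei.symm a]) eΓ
  let Q₇ : Prog (hostΓ ΓV M) (Option A × ρ) := move _ (.inr ⟨false, (M false).k₁⟩)
    (.inl (.inr (some false))) (A := A) (fun a => .inr (.inr (h₂.eo a))) (fun a => [h₂.eo a])
    (eΘ.comp h₂.eo.injective)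
  let Q₈ : Prog (hostΓ ΓV M) (Option A × ρ) := move _ (.inl (.inr (some false)))
    (.inl (.inr none)) (A := A) (fun a => .inr (.inr a)) (fun a => [some (.inr a)]) eΘ
  let Q₉ : Prog (hostΓ ΓV M) (Option A × ρ) := push A ρ (.inl (.inr none)) [none]
  let Q₁₀ : Prog (hostΓ ΓV M) (Option A × ρ) := move _ (.inl (.inr (some true)))
    (.inl (.inr none)) (A := A) (fun a => .inr (.inl a)) (fun a => [some (.inl a)]) eΔ
  have : ∀ i, Finite (M i).σ := fun i => (M i).σFin.finite
  have : ∀ i, Finite (M i).K := fun i => (M i).kFin.finite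
  have : Finite A := inferInstanceAs (Finite (Γ ⊕ Δ ⊕ Θ))
  have : Finite ρ := inferInstanceAs (Finite (∀ i, (M i).σ))
  refine polyMap_of_runs (seq dup <| seq Q₂ <| seq (callSub ΓV A M true) <| seq Q₄ <| seq Q₅ <|
      seq (callSub ΓV A M false) <| seq Q₇ <| seq Q₈ <| seq Q₉ Q₁₀) (r := r)
    (k₀ := .inl (.inl none)) (k₁ := .inl (.inr none)) (Equiv.refl Γ) (Equiv.refl _)
    (10 * .X + p₁ + p₂ + 6 * q₁ + 6 * q₂ + 8) fun x => ?_
  have r₂ : Q₂.Runs r _ _ _ :=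
    runs_load (ΓV := ΓV) (v := .inl (some true)) (a := st [] (u x).reverse (u x).reverse [] [] [])
      (a' := st [] [] (u x).reverse [] [] []) eΓ h₁.ei.symm
      (l := (u x).reverse) rfl rfl
      (by rintro ((_ | _ | _) | _ | _ | _) h <;> first | rfl | exact absurd rfl h)
  rw [List.reverse_reverse] at r₂
  have r₃ := h₁.runs (A := A) x (ΓV := ΓV) (st [] [] (u x).reverse [] [] [])
  have r₄ : Q₄.Runs r _ _ _ :=
    runs_unload (ΓV := ΓV) (w := .inr (some true)) (a := st [] [] (u x).reverse [] [] [])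
      (a' := st [] [] (u x).reverse (v x).reverse [] []) (l := (v x).map h₁.eo.symm)
      (eΔ.comp h₁.eo.injective) h₁.eo (by simp [st])
      (by rintro ((_ | _ | _) | _ | _ | _) h <;> first | rfl | exact absurd rfl h)
  have r₅ : Q₅.Runs r _ _ _ :=
    runs_load (ΓV := ΓV) (v := .inl (some false)) (a := st [] [] (u x).reverse (v x).reverse [] [])
      (a' := st [] [] [] (v x).reverse [] []) eΓ h₂.ei.symm
      (l := (u x).reverse) rfl rfl
      (by rintro ((_ | _ | _) | _ | _ | _) h <;> first | rfl | exact absurd rfl h)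
  rw [List.reverse_reverse] at r₅
  have r₆ := h₂.runs (A := A) x (ΓV := ΓV) (st [] [] [] (v x).reverse [] [])
  have r₇ : Q₇.Runs r _ _ _ :=
    runs_unload (ΓV := ΓV) (w := .inr (some false)) (a := st [] [] [] (v x).reverse [] [])
      (a' := st [] [] [] (v x).reverse (w x).reverse []) (l := (w x).map h₂.eo.symm)
      (eΘ.comp h₂.eo.injective) h₂.eo (by simp [st])
      (by rintro ((_ | _ | _) | _ | _ | _) h <;> first | rfl | exact absurd rfl h)
  have r₈ : Q₈.Runs r _ _ _ :=
    runs_transfer (ΓV := ΓV) (v := .inr (some false)) (w := .inr none)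
      (a := st [] [] [] (v x).reverse (w x).reverse [])
      (a' := st [] [] [] (v x).reverse [] ((w x).map fun a => some (.inr a))) eΘ (by simp)
      (fun a => some (.inr a)) (l := (w x).reverse) rfl rfl (by simp [st])
      (by rintro ((_ | _ | _) | _ | _ | _) h h' <;>
        first | rfl | exact absurd rfl h | exact absurd rfl h') fun _ _ => []
  have r₉ : Q₉.Runs r _ _ _ :=
    runs_push_of (Γ := hostΓ ΓV M) (k := .inl (.inr none))
      (S := hostStk (st [] [] [] (v x).reverse [] ((w x).map fun a => some (.inr a))) fun _ _ => [])
      (T := hostStk (st [] [] [] (v x).reverse [] (none :: (w x).map fun a => some (.inr a)))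
        fun _ _ => []) [none] rfl
      (by rintro (((_ | _ | _) | _ | _ | _) | _) h <;> first | rfl | exact absurd rfl h)
  have r₁₀ : Q₁₀.Runs r _ _ _ :=
    runs_transfer (ΓV := ΓV) (v := .inr (some true)) (w := .inr none)
      (a := st [] [] [] (v x).reverse [] (none :: (w x).map fun a => some (.inr a)))
      (a' := st [] [] [] [] [] (pairStr (v x) (w x))) eΔ (by simp)
      (fun a => some (.inl a)) (l := (v x).reverse) rfl rfl (by simp [st, pairStr])
      (by rintro ((_ | _ | _) | _ | _ | _) h h' <;>
        first | rfl | exact absurd rfl h | exact absurd rfl h') fun _ _ => []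
  rw [Equiv.refl_symm, Equiv.coe_refl, List.map_id, Equiv.refl_symm, Equiv.coe_refl, List.map_id,
    update_nil_inl (ΓV := ΓV) (M := M) (v := .inl none) (a := st (u x) [] [] [] [] [])
      rfl (by rintro ((_ | _ | _) | _ | _ | _) h <;> first | rfl | exact absurd rfl h),
    update_nil_inl (ΓV := ΓV) (M := M) (v := .inr none)
      (a := st [] [] [] [] [] (pairStr (v x) (w x))) rfl
      (by rintro ((_ | _ | _) | _ | _ | _) h <;> first | rfl | exact absurd rfl h)]
  refine ((r₁ _).seq <| r₂.seq <| r₃.seq <| r₄.seq <| r₅.seq <| r₆.seq <| r₇.seq <| r₈.seq <|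
    r₉.seq r₁₀).mono ?_
  have := hq₁ x
  have := hq₂ x
  simp
  omega

set_option maxHeartbeats 400000 in
/-- Iteration over a string `l x`, when the intermediate results have polynomial length. -/
theorem polyMap_foldr {X Y Γ S : Type} [Finite Γ] [Finite S] {e : Y → List Γ} {step : S → Y → Y}
    (hstep : ∀ s, PolyMap e fun y => e (step s y)) (y : X → Y) (l : X → List S) (b : Polynomial ℕ)
    (hb : ∀ x, ∀ l', l' <:+ l x →
      (e (l'.foldr step (y x))).length ≤ b.eval ((e (y x)).length + (l x).length)) :
    PolyMap (fun x => pairStr (e (y x)) (l x)) fun x => e ((l x).foldr step (y x)) := by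
  classical
  have := Fintype.ofFinite S
  choose M p h using fun s => (hstep s).exists_computes
  replace h := fun s => (h s).some
  let A := Option (Γ ⊕ S)
  let ΓV : Bool ⊕ Bool → Type := fun k => match k with
    | .inl _ => Γ
    | .inr true => Option (Γ ⊕ S)
    | .inr false => S
  let st (c o : List Γ) (i : List (Option (Γ ⊕ S))) (q : List S) :
      ∀ k, List (ΓV k) := fun k => match k with
    | .inl true => c
    | .inl false => o
    | .inr true => i
    | .inr false => q
  let ρ := ∀ i, (M i).σ
  let r : ρ := fun i => (M i).initialState
  have eI : Injective (id : A → A) := injective_id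
  have eΓ : Injective (fun a : Γ => (some (.inl a) : A)) := fun a b h => by simpa using h
  have eS : Injective (fun a : S => (some (.inr a) : A)) := fun a b h => by simpa using h
  have : ∀ i, Finite (M i).σ := fun i => (M i).σFin.finite
  have : ∀ i, Finite (M i).K := fun i => (M i).kFin.finite
  have : Finite A := inferInstanceAs (Finite (Option (Γ ⊕ S)))
  have : Finite ρ := inferInstanceAs (Finite (∀ i, (M i).σ))
  -- The input is split into its two components; the separator is dropped by an empty push.
  let body₁ : Option (Γ ⊕ S) → Prog (hostΓ ΓV M) (Option A × ρ)
    | none => push (Γ := hostΓ ΓV M) A ρ (.inl (.inl true)) []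
    | some (.inl a) => push (Γ := hostΓ ΓV M) A ρ (.inl (.inl true)) [a]
    | some (.inr s) => push (Γ := hostΓ ΓV M) A ρ (.inl (.inr false)) [s]
  let Q₁ : Prog (hostΓ ΓV M) (Option A × ρ) :=
    loop (Γ := hostΓ ΓV M) (.inl (.inr true)) (A := A) id body₁ eI
  let body₂ (s : S) : Prog (hostΓ ΓV M) (Option A × ρ) :=
    seq (move _ (.inl (.inl true)) (.inr ⟨s, (M s).k₀⟩) (A := A) (fun a => some (.inl a))
      (fun a => [(h s).ei.symm a]) eΓ) <| seq (callSub ΓV A M s) <|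
    move _ (.inr ⟨s, (M s).k₁⟩) (.inl (.inl true)) (A := A) (fun a => some (.inl ((h s).eo a)))
      (fun a => [(h s).eo a]) (eΓ.comp (h s).eo.injective)
  -- After the splitting, `l x` lies reversed on its stack, so its last symbol is popped first, as a
  -- right fold requires. Each symbol selects its own subroutine.
  let Q₂ : Prog (hostΓ ΓV M) (Option A × ρ) :=
    loop (Γ := hostΓ ΓV M) (.inl (.inr false)) (A := A) (fun a => some (.inr a)) body₂ eS
  let Q₃ : Prog (hostΓ ΓV M) (Option A × ρ) := move _ (.inl (.inl true)) (.inl (.inl false))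
    (A := A) (fun a => some (.inl a)) (fun a => [a]) eΓ
  -- The summands pay for the splitting, for the rounds of the fold (load, call and unload, with
  -- strings of length at most `b`), and for the final reversal.
  refine polyMap_of_runs (seq Q₁ <| seq Q₂ Q₃) (r := r)
    (k₀ := .inl (.inr true)) (k₁ := .inl (.inl false)) (Equiv.refl _) (Equiv.refl Γ)
    (3 * .X + 1 + (.X * (6 * b + 5 + (∑ s, p s).comp b) + 1) + (3 * b + 1)) fun x => ?_
  have r₁ : Q₁.Runs r (hostStk (st [] [] (pairStr (e (y x)) (l x)) []) fun _ _ => [])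
      (hostStk (st (e (y x)).reverse [] [] (l x).reverse) fun _ _ => [])
      ((pairStr (e (y x)) (l x)).length * (1 + 2) + 1) := by
    let g (c : List Γ × List S) : Option (Γ ⊕ S) → List Γ × List S
      | none => c
      | some (.inl a) => (a :: c.1, c.2)
      | some (.inr s) => (c.1, s :: c.2)
    have := runs_loop_foldl (Γ := hostΓ ΓV M) (r := r) (k := .inl (.inr true)) (body := body₁) eI
      (fun i (c : List Γ × List S) => hostStk (st c.1 [] i c.2) fun _ _ => []) g 1
      (fun _ _ => rfl) (by
        rintro i i' c (((_ | _) | _ | _) | _) h <;> first | rfl | exact absurd rfl h)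
      (by
        rintro (_ | a | s) i c
        · exact runs_push_of (Γ := hostΓ ΓV M) (k := .inl (.inl true)) [] rfl fun _ _ => rfl
        · exact runs_push_of (Γ := hostΓ ΓV M) (k := .inl (.inl true)) [a] rfl (by
            rintro (((_ | _) | _ | _) | _) h <;> first | rfl | exact absurd rfl h)
        · exact runs_push_of (Γ := hostΓ ΓV M) (k := .inl (.inr false)) [s] rfl (by
            rintro (((_ | _) | _ | _) | _) h <;> first | rfl | exact absurd rfl h))
      (pairStr (e (y x)) (l x)) ([], [])
    have hg₁ (u : List Γ) (c) : (u.map fun a => some (.inl a)).foldl g c =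
        (u.reverse ++ c.1, c.2) := by
      induction u generalizing c with
      | nil => rfl
      | cons a u ih => simp [ih, g]
    have hg₂ (u : List S) (c) : (u.map fun a => some (.inr a)).foldl g c =
        (c.1, u.reverse ++ c.2) := by
      induction u generalizing c with
      | nil => rfl
      | cons a u ih => simp [ih, g]
    rw [pairStr, List.foldl_append, List.foldl_cons, hg₁, hg₂] at this
    simpa [g, pairStr] using this
  have r₂ (B : ℕ) (q : List S) (c : Y)
      (hB : ∀ l', l' <:+ q.reverse → (e (l'.foldr step c)).length ≤ B) :
      Q₂.Runs r (hostStk (st (e c).reverse [] [] q) fun _ _ => [])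
      (hostStk (st (e (q.reverse.foldr step c)).reverse [] [] []) fun _ _ => [])
      (q.length * (6 * B + 4 + (∑ s, p s).eval B) + 1) := by
    induction q generalizing c with
    | nil => exact (runs_loop_nil (Γ := hostΓ ΓV M) eS rfl).mono (by simp)
    | cons s q ih =>
      have hB₀ : (e c).length ≤ B := hB [] (List.nil_suffix ..)
      have hB₁ : (e (step s c)).length ≤ B := hB [s] (by simp)
      have hs : (p s).eval (e c).length ≤ (∑ s, p s).eval B := by
        rw [Polynomial.eval_finsetSum]
        exact (eval_mono _ hB₀).trans
          (Finset.single_le_sum (f := fun s => (p s).eval B) (fun _ _ => Nat.zero_le _)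
            (Finset.mem_univ s))
      have t₁ : Prog.Runs r _ _ _ _ :=
        runs_load (ΓV := ΓV) (A := A) (v := .inl true) (a := st (e c).reverse [] [] q)
          (a' := st [] [] [] q) eΓ (h s).ei.symm (l := (e c).reverse) rfl rfl
          (by rintro ((_ | _) | _ | _) h <;> first | rfl | exact absurd rfl h)
      rw [List.reverse_reverse] at t₁
      have t₂ := (h s).runs (A := A) c (ΓV := ΓV) (st [] [] [] q)
      have t₃ : Prog.Runs r _ _ _ _ :=
        runs_unload (ΓV := ΓV) (A := A) (w := .inl true) (a := st [] [] [] q)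
          (a' := st (e (step s c)).reverse [] [] q) (l := (e (step s c)).map (h s).eo.symm)
          (eΓ.comp (h s).eo.injective) (h s).eo (by simp [st])
          (by rintro ((_ | _) | _ | _) h <;> first | rfl | exact absurd rfl h)
      have ih := ih (step s c) fun l' hl' => by
        obtain ⟨t, ht⟩ := hl'
        simpa using hB (l' ++ [s]) ⟨t, by simp [← ht]⟩
      rw [List.reverse_cons, List.foldr_append]
      refine (runs_loop_cons_of (Γ := hostΓ ΓV M) (k := .inl (.inr false)) (body := body₂) eS
        (T := hostStk (st (e c).reverse [] [] q) fun _ _ => []) (a := s) (l := q) rfl rfl (by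
          rintro (((_ | _) | _ | _) | _) h <;> first | rfl | exact absurd rfl h)
        (t₁.seq (t₂.seq t₃)) ih).mono ?_
      simp [Nat.succ_mul]
      omega
  have r₃ (z : List Γ) : Q₃.Runs r (hostStk (st z.reverse [] [] []) fun _ _ => [])
      (hostStk (st [] z [] []) fun _ _ => []) (3 * z.reverse.length + 1) :=
    runs_transfer (ΓV := ΓV) (v := .inl true) (w := .inl false) eΓ (by simp) (fun a => a) rfl rfl
      (by simp [st])
      (by rintro ((_ | _) | _ | _) h h' <;>
        first | rfl | exact absurd rfl h | exact absurd rfl h') fun _ _ => []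
  rw [Equiv.refl_symm, Equiv.coe_refl, List.map_id, Equiv.refl_symm, Equiv.coe_refl, List.map_id,
    update_nil_inl (ΓV := ΓV) (M := M) (v := .inr true) (a := st [] [] (pairStr (e (y x)) (l x)) [])
      rfl (by rintro ((_ | _) | _ | _) h <;> first | rfl | exact absurd rfl h),
    update_nil_inl (ΓV := ΓV) (M := M) (v := .inl false)
      (a := st [] (e ((l x).foldr step (y x))) [] []) rfl
      (by rintro ((_ | _) | _ | _) h <;> first | rfl | exact absurd rfl h)]
  have r₂ := r₂ (b.eval ((e (y x)).length + (l x).length)) (l x).reverse (y x)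
    (by simpa using hb x)
  rw [List.reverse_reverse] at r₂
  refine (r₁.seq (r₂.seq (r₃ _))).mono ?_
  have h₁ := hb x _ List.suffix_rfl
  have h₂ : b.eval ((e (y x)).length + (l x).length) ≤
      b.eval (pairStr (e (y x)) (l x)).length := eval_mono _ (by rw [length_pairStr]; omega)
  have h₃ := eval_mono (∑ s, p s) h₂
  simp only [Polynomial.eval_add, Polynomial.eval_mul, Polynomial.eval_X, Polynomial.eval_ofNat,
    Polynomial.eval_one, Polynomial.eval_comp]
  have h₄ : (l x).length ≤ (pairStr (e (y x)) (l x)).length := by rw [length_pairStr]; omega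
  rw [add_assoc (_ + 1)]
  refine add_le_add (by omega) (add_le_add (add_le_add (Nat.mul_le_mul (by simpa using h₄) ?_)
    le_rfl) ?_)
  · omega
  · simp; omega

/-! ### A calculus of polynomial-time string operations -/

variable {X Y Γ Δ Θ S : Type} [Finite Γ] [Finite Δ] [Finite Θ] [Finite S] {u : X → List Γ}

theorem PolyMap.refl (u : X → List Γ) : PolyMap u u := by
  simpa using polyMap_append_flatMap u [] fun a => [a]

theorem flatMap_nil_right {α β : Type} (l : List α) : l.flatMap (fun _ => ([] : List β)) = [] := by
  induction l <;> simp_all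

theorem PolyMap.const {Ξ : Type} (u : X → List Γ) (c : List Ξ) : PolyMap u fun _ => c := by
  simpa [flatMap_nil_right] using polyMap_append_flatMap u c fun _ => ([] : List Ξ)

theorem PolyMap.flatMap {Ξ : Type} {v : X → List Δ} (h : PolyMap u v) (g : Δ → List Ξ) :
    PolyMap u fun x => (v x).flatMap g :=
  h.trans (by simpa using polyMap_append_flatMap v [] g)

theorem PolyMap.map {Ξ : Type} {v : X → List Δ} (h : PolyMap u v) (g : Δ → Ξ) :
    PolyMap u fun x => (v x).map g := by
  simpa only [flatMap_singleton_eq_map] using h.flatMap fun a => [g a]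

theorem PolyMap.fst {v : X → List Δ} {w : X → List Θ} (h : PolyMap u fun x => pairStr (v x) (w x)) :
    PolyMap u v := by
  refine cast (congrArg _ ?_) (h.flatMap fun a => match a with
    | some (.inl a) => [a]
    | _ => [])
  simp [pairStr, List.flatMap_append, List.flatMap_map, flatMap_nil_right]

theorem PolyMap.snd {v : X → List Δ} {w : X → List Θ} (h : PolyMap u fun x => pairStr (v x) (w x)) :
    PolyMap u w := by
  refine cast (congrArg _ ?_) (h.flatMap fun a => match a with
    | some (.inr a) => [a]
    | _ => [])
  simp [pairStr, List.flatMap_append, List.flatMap_map, flatMap_nil_right]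

theorem PolyMap.append {v w : X → List Δ} (hv : PolyMap u v) (hw : PolyMap u w) :
    PolyMap u fun x => v x ++ w x := by
  refine cast (congrArg _ ?_) ((hv.pair hw).flatMap fun a => match a with
    | some (.inl a) => [a]
    | some (.inr a) => [a]
    | none => [])
  simp [pairStr, List.flatMap_append, List.flatMap_map]

theorem PolyMap.cons {v : X → List Δ} (a : Δ) (hv : PolyMap u v) : PolyMap u fun x => a :: v x :=
  (PolyMap.const u [a]).append hv

/-- What can be computed from `u` can be computed from `u` and a further string. -/
theorem PolyMap.ofFst {Ξ : Type} {v : X → List Ξ} (h : PolyMap u v) (e : Y → List Θ) :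
    PolyMap (fun p : X × Y => pairStr (u p.1) (e p.2)) fun p => v p.1 :=
  (PolyMap.refl _).fst.trans (h.reindex Prod.fst)

/-- The step may consult `x`, so `x` is carried along unchanged in the accumulator. The bound `hb`
on intermediate results is indispensable: iterating a polynomial-time step may otherwise produce
exponential length. -/
theorem PolyMap.foldr {e : Y → List Δ} {step : S → X → Y → Y}
    (hstep : ∀ s, PolyMap (fun p : X × Y => pairStr (u p.1) (e p.2)) fun p => e (step s p.1 p.2))
    {y : X → Y} (hy : PolyMap u fun x => e (y x)) {l : X → List S} (hl : PolyMap u l)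
    (b : Polynomial ℕ) (hb : ∀ x, ∀ l', l' <:+ l x →
      (e (l'.foldr (fun s => step s x) (y x))).length ≤ b.eval (u x).length) :
    PolyMap u fun x => e ((l x).foldr (fun s => step s x) (y x)) := by
  have key (x : X) (l : List S) : l.foldr (fun s (p : X × Y) => (p.1, step s p.1 p.2)) (x, y x) =
      (x, l.foldr (fun s => step s x) (y x)) := by
    induction l with
    | nil => rfl
    | cons s l ih => simp [ih]
  have := polyMap_foldr (e := fun p : X × Y => pairStr (u p.1) (e p.2))
    (step := fun s p => (p.1, step s p.1 p.2)) (fun s => ((PolyMap.refl u).ofFst e).pair (hstep s))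
    (fun x => (x, y x)) l (.X + b + 1) fun x l' hl' => by
      rw [key, length_pairStr]
      have h₁ := hb x l' hl'
      have h₂ := eval_mono b (show (u x).length ≤
        (pairStr (u x) (e (y x))).length + (l x).length by rw [length_pairStr]; omega)
      simp only [Polynomial.eval_add, Polynomial.eval_X, Polynomial.eval_one, length_pairStr] at *
      omega
  simp only [key] at this
  exact (((PolyMap.refl u).pair hy).pair hl |>.trans this).snd

/-- The number `n` in unary. -/
def unary (n : ℕ) : List Unit := List.replicate n ()

@[simp] theorem length_unary (n : ℕ) : (unary n).length = n := by simp [unary]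

theorem unary_length {α : Type} (l : List α) : l.map (fun _ => ()) = unary l.length := by
  simp [unary, List.map_const']

theorem PolyMap.length {v : X → List Δ} (h : PolyMap u v) :
    PolyMap u fun x => unary (v x).length := by
  simpa only [unary_length] using h.map fun _ => ()

/-- A fold over the unary counter, whose symbols carry no information. -/
theorem PolyMap.iterate {e : Y → List Δ} {f : X → Y → Y}
    (hf : PolyMap (fun p : X × Y => pairStr (u p.1) (e p.2)) fun p => e (f p.1 p.2))
    {y : X → Y} (hy : PolyMap u fun x => e (y x)) {n : X → ℕ} (hn : PolyMap u fun x => unary (n x))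
    (b : Polynomial ℕ) (hb : ∀ x, ∀ m ≤ n x,
      (e ((f x)^[m] (y x))).length ≤ b.eval (u x).length) :
    PolyMap u fun x => e ((f x)^[n x] (y x)) := by
  have key (x : X) (l : List Unit) : l.foldr (fun _ => f x) (y x) = (f x)^[l.length] (y x) := by
    induction l with
    | nil => rfl
    | cons s l ih => simp [ih, iterate_succ_apply']
  have := PolyMap.foldr (S := Unit) (e := e) (step := fun _ => f) (fun _ => hf) hy hn b
    fun x l' hl' => by
      rw [key]
      exact hb x _ (by simpa using hl'.length_le)
  simpa only [key, length_unary] using this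

/-- A case distinction on the first symbol of a string. -/
theorem PolyMap.cases {v : X → List S} (hv : PolyMap u v) {g₀ : X → List Δ} (h₀ : PolyMap u g₀)
    {g : S → X → List Δ} (hg : ∀ s, PolyMap u (g s)) :
    PolyMap u fun x => (v x).head?.elim (g₀ x) fun s => g s x := by
  have := Fintype.ofFinite S
  obtain ⟨b₀, hb₀⟩ := h₀.exists_length_le
  choose b hb using fun s => (hg s).exists_length_le
  -- A right fold that ignores its accumulator keeps only the outermost step, which belongs to the
  -- first symbol.
  have key (x : X) (l : List S) : l.foldr (fun s _ => g s x) (g₀ x) =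
      l.head?.elim (g₀ x) fun s => g s x := by
    cases l <;> rfl
  have := PolyMap.foldr (e := fun w : List Δ => w) (step := fun s x _ => g s x)
    (fun s => (hg s).ofFst fun w : List Δ => w) h₀ hv (b₀ + ∑ s, b s) fun x l _ => by
      rw [key, Polynomial.eval_add, Polynomial.eval_finsetSum]
      cases l with
      | nil => exact (hb₀ x).trans (Nat.le_add_right _ _)
      | cons s l =>
        exact ((hb s x).trans (Finset.single_le_sum (f := fun s => (b s).eval (u x).length)
          (fun _ _ => Nat.zero_le _) (Finset.mem_univ s))).trans (Nat.le_add_left _ _)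
  simpa only [key] using this

theorem PolyMap.head {v : X → List S} (hv : PolyMap u v) : PolyMap u fun x => (v x).take 1 := by
  have := hv.cases (g₀ := fun _ => []) (PolyMap.const u []) fun s => PolyMap.const u [s]
  refine cast (congrArg _ (funext fun x => ?_)) this
  cases v x <;> rfl

/-- As for the predecessor function, the fold computes the string and its tail together. -/
theorem PolyMap.tail {v : X → List S} (hv : PolyMap u v) : PolyMap u fun x => (v x).tail := by
  obtain ⟨b, hb⟩ := hv.exists_length_le
  have key (l : List S) : l.foldr (fun s (p : List S × List S) => (s :: p.1, p.1)) ([], []) =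
      (l, l.tail) := by
    induction l with
    | nil => rfl
    | cons s l ih => simp [ih]
  have := PolyMap.foldr (u := u) (e := fun p : List S × List S => pairStr p.1 p.2)
    (step := fun s _ p => (s :: p.1, p.1))
    (fun s => by
      have h : PolyMap (fun p : X × (List S × List S) => pairStr (u p.1) (pairStr p.2.1 p.2.2))
        fun p => pairStr p.2.1 p.2.2 := (PolyMap.refl _).snd
      exact (h.fst.cons s).pair h.fst)
    (y := fun _ => ([], [])) (PolyMap.const u _) hv (2 * b + 1) fun x l hl => by
      have := hb x
      have := hl.length_le
      rw [key, length_pairStr]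
      simp
      omega
  simp only [key] at this
  exact this.snd

theorem iterate_tail {α : Type} (l : List α) (n : ℕ) :
    (fun p : List α × List α => (p.1.tail, p.2 ++ p.1.take 1))^[n] (l, []) =
      (l.drop n, l.take n) := by
  induction n with
  | zero => simp
  | succ n ih =>
    rw [iterate_succ_apply', ih]
    simp [List.take_add]

theorem PolyMap.drop_take {v : X → List S} (hv : PolyMap u v) {n : X → ℕ}
    (hn : PolyMap u fun x => unary (n x)) :
    PolyMap u fun x => pairStr ((v x).drop (n x)) ((v x).take (n x)) := by
  obtain ⟨b, hb⟩ := hv.exists_length_le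
  have h : PolyMap (fun p : X × (List S × List S) => pairStr (u p.1) (pairStr p.2.1 p.2.2))
    fun p => pairStr p.2.1 p.2.2 := (PolyMap.refl _).snd
  have := PolyMap.iterate (e := fun p : List S × List S => pairStr p.1 p.2)
    (f := fun _ p => (p.1.tail, p.2 ++ p.1.take 1))
    (h.fst.tail.pair (h.snd.append h.fst.head)) (y := fun x => (v x, []))
    (hv.pair (PolyMap.const u _)) hn (b + 1) fun x m _ => by
      have := hb x
      rw [iterate_tail, length_pairStr]
      simp
      omega
  simpa only [iterate_tail] using this

theorem PolyMap.drop {v : X → List S} (hv : PolyMap u v) {n : X → ℕ}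
    (hn : PolyMap u fun x => unary (n x)) : PolyMap u fun x => (v x).drop (n x) :=
  (hv.drop_take hn).fst

theorem PolyMap.take {v : X → List S} (hv : PolyMap u v) {n : X → ℕ}
    (hn : PolyMap u fun x => unary (n x)) : PolyMap u fun x => (v x).take (n x) :=
  (hv.drop_take hn).snd

/-- The symbols at even positions, and those at odd positions. -/
def split {S : Type} : List S → List S × List S
  | [] => ([], [])
  | s :: l => (s :: (split l).2, (split l).1)

theorem split_length {α : Type} (l : List α) :
    (split l).1.length = (l.length + 1) / 2 ∧ (split l).2.length = l.length / 2 := by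
  induction l with
  | nil => simp [split]
  | cons s l ih => simp only [split, List.length_cons]; omega

theorem PolyMap.split {v : X → List S} (hv : PolyMap u v) :
    PolyMap u fun x => pairStr (StackProgram.split (v x)).1 (StackProgram.split (v x)).2 := by
  obtain ⟨b, hb⟩ := hv.exists_length_le
  have key (l : List S) : l.foldr (fun s (p : List S × List S) => (s :: p.2, p.1)) ([], []) =
      StackProgram.split l := by
    induction l with
    | nil => rfl
    | cons s l ih => simp [ih, StackProgram.split]
  have := PolyMap.foldr (u := u) (e := fun p : List S × List S => pairStr p.1 p.2)
    (step := fun s _ p => (s :: p.2, p.1))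
    (fun s => by
      have h : PolyMap (fun p : X × (List S × List S) => pairStr (u p.1) (pairStr p.2.1 p.2.2))
        fun p => pairStr p.2.1 p.2.2 := (PolyMap.refl _).snd
      exact (h.snd.cons s).pair h.fst)
    (y := fun _ => ([], [])) (PolyMap.const u _) hv (b + 1) fun x l hl => by
      have := hb x
      have := hl.length_le
      have := split_length l
      rw [key, length_pairStr]
      simp
      omega
  simpa only [key] using this

/-! ### Arithmetic in unary, and conversion from binary -/

section Unary

variable {m n : X → ℕ}

theorem unary_add (a b : ℕ) : unary (a + b) = unary a ++ unary b :=
  List.replicate_add ..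

theorem PolyMap.unary_const (u : X → List Γ) (c : ℕ) : PolyMap u fun _ => unary c :=
  PolyMap.const u _

theorem PolyMap.unary_add (hm : PolyMap u fun x => unary (m x))
    (hn : PolyMap u fun x => unary (n x)) :
    PolyMap u fun x => unary (m x + n x) := by
  simpa only [StackProgram.unary_add] using hm.append hn

theorem PolyMap.unary_mul (hm : PolyMap u fun x => unary (m x))
    (hn : PolyMap u fun x => unary (n x)) :
    PolyMap u fun x => unary (m x * n x) := by
  obtain ⟨b, hb⟩ := hm.exists_length_le
  obtain ⟨c, hc⟩ := hn.exists_length_le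
  have key (a k : ℕ) : (fun b => b + a)^[k] 0 = a * k := by
    induction k with
    | zero => rfl
    | succ k ih => rw [iterate_succ_apply', ih, Nat.mul_succ]
  have := PolyMap.iterate (e := unary) (f := fun x k => k + m x)
    (PolyMap.unary_add (PolyMap.refl _).snd (hm.ofFst _)) (y := fun _ => 0)
    (PolyMap.unary_const u 0) hn (b * c) fun x k hk => by
      rw [key, length_unary, Polynomial.eval_mul]
      have := hb x
      have := hc x
      rw [length_unary] at *
      exact Nat.mul_le_mul ‹_› (hk.trans this)
  simpa only [key] using this

theorem PolyMap.unary_eval (hm : PolyMap u fun x => unary (m x)) (p : Polynomial ℕ) :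
    PolyMap u fun x => unary (p.eval (m x)) := by
  induction p using Polynomial.induction_on' with
  | add p q hp hq => simpa only [Polynomial.eval_add] using hp.unary_add hq
  | monomial k c =>
    simp only [Polynomial.eval_monomial]
    refine (PolyMap.unary_const u c).unary_mul ?_
    induction k with
    | zero => exact PolyMap.unary_const u 1
    | succ k ih => simpa only [pow_succ] using ih.unary_mul hm

/-- The odd positions of a string of length `m` number `m / 2`, rounded down. -/
theorem PolyMap.unary_half (hm : PolyMap u fun x => unary (m x)) :
    PolyMap u fun x => unary (m x / 2) := by
  have := hm.split.snd.length
  simpa only [split_length, length_unary] using this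

theorem take_one_unary (k : ℕ) : (unary k).take 1 = unary (min k 1) := by
  simp [unary, List.take_replicate, min_comm]

/-- The bit length is the number of halvings before reaching 0; `min p.1 1` stops the count there,
so surplus iterations are harmless. -/
theorem iterate_half (a k : ℕ) (n : ℕ) (h : a < 2 ^ n) :
    ((fun p : ℕ × ℕ => (p.1 / 2, p.2 + min p.1 1))^[n] (a, k)).2 = k + a.size := by
  induction n generalizing a k with
  | zero => obtain rfl : a = 0 := by simpa using h
            simp
  | succ n ih =>
    rw [iterate_succ_apply, ih _ _ (by omega)]
    rcases Nat.eq_zero_or_pos a with rfl | ha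
    · simp
    · have : a.size = (a / 2).size + 1 := by
        conv_lhs => rw [← Nat.bit_bodd_div2 a]
        rw [Nat.size_bit (by rw [Nat.bit_bodd_div2]; omega), Nat.div2_val]
      simp only
      omega

theorem PolyMap.unary_size (hm : PolyMap u fun x => unary (m x)) :
    PolyMap u fun x => unary (m x).size := by
  obtain ⟨b, hb⟩ := hm.exists_length_le
  have h : PolyMap (fun p : X × (ℕ × ℕ) => pairStr (u p.1) (pairStr (unary p.2.1) (unary p.2.2)))
    fun p => pairStr (unary p.2.1) (unary p.2.2) := (PolyMap.refl _).snd
  have hle (a k : ℕ) : ((fun p : ℕ × ℕ => (p.1 / 2, p.2 + min p.1 1))^[k] (a, 0)).1 ≤ a ∧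
      ((fun p : ℕ × ℕ => (p.1 / 2, p.2 + min p.1 1))^[k] (a, 0)).2 ≤ k := by
    induction k with
    | zero => simp
    | succ k ih => rw [iterate_succ_apply']; simp only; omega
  have := PolyMap.iterate (e := fun p : ℕ × ℕ => pairStr (unary p.1) (unary p.2))
    (f := fun _ p => (p.1 / 2, p.2 + min p.1 1))
    (h.fst.unary_half.pair (h.snd.unary_add (by simpa only [take_one_unary] using h.fst.head)))
    (y := fun x => (m x, 0)) (hm.pair (PolyMap.unary_const u 0)) hm (2 * b + 1) fun x k hk => by
      have := hb x
      have := hle (m x) k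
      rw [length_unary] at *
      rw [length_pairStr, length_unary, length_unary]
      simp
      omega
  have := this.snd
  simp only [iterate_half _ 0 _ Nat.lt_two_pow_self] at this
  simpa using this

end Unary

/-- The number with the binary digits `l`. -/
def ofBits (l : List Bool) : ℕ := l.foldr (fun b k => 2 * k + b.toNat) 0

theorem ofBits_le_of_suffix {l l' : List Bool} (h : l' <:+ l) : ofBits l' ≤ ofBits l := by
  obtain ⟨t, rfl⟩ := h
  induction t with
  | nil => rfl
  | cons b t ih => exact ih.trans (by simp only [ofBits, List.cons_append, List.foldr_cons]; omega)

/-- Horner's scheme from the high digits down. All intermediate values belong to suffixes and stay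
below the final value, which must be polynomial because it is written in unary. -/
theorem PolyMap.unary_ofBits {l : X → List Bool} (hl : PolyMap u l) (b : Polynomial ℕ)
    (hb : ∀ x, ofBits (l x) ≤ b.eval (u x).length) : PolyMap u fun x => unary (ofBits (l x)) := by
  refine PolyMap.foldr (e := unary) (step := fun b _ k => 2 * k + b.toNat) (fun s => ?_)
    (y := fun _ => 0) (PolyMap.unary_const u 0) hl b fun x l' hl' => ?_
  · exact ((PolyMap.unary_const _ 2).unary_mul (PolyMap.refl _).snd).unary_add
      (PolyMap.unary_const _ _)
  · rw [length_unary]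
    exact (ofBits_le_of_suffix hl').trans (hb x)

/-! ### Random weights and the encoding of a random history -/

instance : Finite RoundSymbol :=
  Finite.of_injective (β := Bool ⊕ Option Bool)
    (fun s => match s with
      | .bit b => .inl b
      | .slash => .inr none
      | .comma => .inr (some true)
      | .semicolon => .inr (some false))
    (by rintro (_ | _ | _ | _) (_ | _ | _ | _) h <;> simp_all)

/-- A weight from a block of coin flips: `1` if all of them are `true`, and `0` otherwise. -/
def weightOf (l : List Bool) : ℚ≥0 := if l.all id then 1 else 0

/-- The weights of all rounds from a sequence of coin flips, `κ` of which are used for each of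
the weights. -/
def randomWeights (n κ : ℕ) (e : List Bool) (i : ℕ) (v : Fin n) : ℚ≥0 :=
  weightOf ((e.drop ((i * n + v) * κ)).take κ)

section PolyMaps

variable {X Γ : Type} [Finite Γ] {u : X → List Γ} {e : X → List Bool} {n κ t : X → ℕ}

/-- There are just two possible encodings, and the choice depends on whether a `false` occurs;
deleting every `true` turns this into a case distinction on a first symbol. -/
theorem encodeWeight_weightOf (l : List Bool) : encodeWeight (weightOf l) =
    (l.flatMap fun b => if b then [] else [()]).head?.elim (encodeWeight 1)
      fun _ => encodeWeight 0 := by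
  have h : (l.flatMap fun b => if b then [] else [()]) = [] ↔ l.all id := by
    simp
  unfold weightOf
  by_cases hl : l.all id
  · rw [if_pos hl, h.2 hl]; rfl
  · rw [if_neg hl]
    obtain ⟨a, m, hm⟩ := List.exists_cons_of_ne_nil (mt h.1 hl)
    rw [hm]
    rfl

theorem PolyMap.encodeWeight_weightOf (he : PolyMap u e) :
    PolyMap u fun x => encodeWeight (weightOf (e x)) := by
  simp only [StackProgram.encodeWeight_weightOf]
  exact (he.flatMap _).cases (PolyMap.const u _) fun _ => PolyMap.const u _

theorem length_encodeWeight_weightOf_le (l : List Bool) :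
    (encodeWeight (weightOf l)).length ≤ 4 := by
  unfold weightOf encodeWeight
  split_ifs <;> simp

theorem length_flatMap_range_le {α : Type} (g : ℕ → List α) (c m : ℕ) (h : ∀ i, (g i).length ≤ c) :
    ((List.range m).flatMap g).length ≤ m * c := by
  induction m with
  | zero => simp
  | succ m ih =>
    rw [List.range_succ, List.flatMap_append, List.length_append, Nat.succ_mul]
    simpa using add_le_add ih (h m)

theorem iterate_blocks {α β : Type} (g : List α → List β) (k : ℕ) (l : List α) (m : ℕ) :
    (fun p : List α × List β => (p.1.drop k, p.2 ++ g p.1))^[m] (l, []) =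
      (l.drop (m * k), (List.range m).flatMap fun i => g (l.drop (i * k))) := by
  induction m with
  | zero => simp
  | succ m ih =>
    rw [iterate_succ_apply', ih]
    simp [List.range_succ, Nat.succ_mul, List.flatMap_append]

/-- Apply `g` to the tails of the string `e x` which begin at multiples of `k x`. -/
theorem PolyMap.blocks {Δ : Type} [Finite Δ] (he : PolyMap u e) {k : X → ℕ}
    (hk : PolyMap u fun x => unary (k x)) (ht : PolyMap u fun x => unary (t x))
    {g : X → List Bool → List Δ}
    (hg : PolyMap (fun p : X × List Bool => pairStr (u p.1) p.2) fun p => g p.1 p.2)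
    (b : Polynomial ℕ) (hb : ∀ x l, (g x l).length ≤ b.eval (u x).length) :
    PolyMap u fun x => (List.range (t x)).flatMap fun i => g x ((e x).drop (i * k x)) := by
  obtain ⟨p, hp⟩ := he.exists_length_le
  obtain ⟨q, hq⟩ := ht.exists_length_le
  have h : PolyMap (fun p : X × (List Bool × List Δ) => pairStr (u p.1) (pairStr p.2.1 p.2.2))
    fun p => pairStr p.2.1 p.2.2 := (PolyMap.refl _).snd
  have := PolyMap.iterate (e := fun p : List Bool × List Δ => pairStr p.1 p.2)
    (f := fun x p => (p.1.drop (k x), p.2 ++ g x p.1))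
    ((h.fst.drop (hk.ofFst fun p : List Bool × List Δ => pairStr p.1 p.2)).pair (h.snd.append
      (((PolyMap.refl _).fst.pair h.fst).trans
        (hg.reindex fun p : X × (List Bool × List Δ) => (p.1, p.2.1)))))
    (y := fun x => (e x, [])) (he.pair (PolyMap.const u _)) ht (p + q * b + 1) fun x m hm => by
      have h₁ := hp x
      have h₂ := hq x
      have h₃ := length_flatMap_range_le (fun i => g x ((e x).drop (i * k x))) _ m fun i => hb x _
      rw [length_unary] at h₂
      have h₄ := Nat.mul_le_mul_right (b.eval (u x).length) (hm.trans h₂)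
      rw [iterate_blocks, length_pairStr]
      simp only [List.length_drop, Polynomial.eval_add, Polynomial.eval_mul, Polynomial.eval_one]
      omega
  simp only [iterate_blocks] at this
  exact this.snd

/-- The weights of one round, from a sequence of coin flips. -/
def roundStr (n κ : ℕ) (e : List Bool) : List RoundSymbol :=
  ((List.range n).flatMap fun v => encodeWeight (weightOf ((e.drop (v * κ)).take κ))) ++ [.semicolon]

theorem PolyMap.roundStr (he : PolyMap u e) (hn : PolyMap u fun x => unary (n x))
    (hκ : PolyMap u fun x => unary (κ x)) : PolyMap u fun x => roundStr (n x) (κ x) (e x) := by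
  refine (PolyMap.blocks he hκ hn (g := fun x l => encodeWeight (weightOf (l.take (κ x)))) ?_ 4
    fun x l => ?_).append (PolyMap.const u _)
  · exact ((PolyMap.refl _).snd.take (hκ.ofFst fun l : List Bool => l)).encodeWeight_weightOf
  · simpa using length_encodeWeight_weightOf_le _

theorem length_roundStr_le (n κ : ℕ) (e : List Bool) :
    (StackProgram.roundStr n κ e).length ≤ 4 * n + 1 := by
  have := length_flatMap_range_le (fun v => encodeWeight (weightOf ((e.drop (v * κ)).take κ))) 4 n
    fun _ => length_encodeWeight_weightOf_le _
  simp only [StackProgram.roundStr, List.length_append, List.length_singleton]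
  omega

theorem encodeWeights_randomWeights (n κ : ℕ) (e : List Bool) (i : ℕ) :
    encodeWeights (randomWeights n κ e i) = StackProgram.roundStr n κ (e.drop (i * (n * κ))) := by
  have h : (List.ofFn fun v : Fin n => encodeWeight (randomWeights n κ e i v)) =
      (List.range n).map fun v => encodeWeight (weightOf ((e.drop ((i * n + v) * κ)).take κ)) := by
    apply List.ext_getElem <;> simp [randomWeights]
  simp only [encodeWeights, h, StackProgram.roundStr, List.flatMap_def, List.drop_drop, add_mul,
    mul_assoc, add_comm]

theorem PolyMap.history {I : X → CardInstance} (hI : PolyMap u fun x => (I x).encode)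
    (he : PolyMap u e) (hn : PolyMap u fun x => unary (I x).n)
    (hκ : PolyMap u fun x => unary (κ x)) (ht : PolyMap u fun x => unary (t x)) :
    PolyMap u fun x => encodeHistory (I x)
      ((List.range (t x)).map (randomWeights (I x).n (κ x) (e x))) := by
  obtain ⟨b, hb⟩ := hn.exists_length_le
  have := he.blocks (hn.unary_mul hκ) ht (g := fun x => StackProgram.roundStr (I x).n (κ x))
    (PolyMap.roundStr (PolyMap.refl _).snd (hn.ofFst fun l : List Bool => l)
      (hκ.ofFst fun l : List Bool => l)) (4 * b + 1) fun x l => by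
      have := hb x
      have := length_roundStr_le (I x).n (κ x) l
      rw [length_unary] at *
      simp
      omega
  simp only [encodeHistory, List.flatMap_map, encodeWeights_randomWeights]
  exact (hI.map _).append (this.cons _)

/-- Reading from the right and resetting the count at every `false` leaves exactly the leading run
of `true`, whatever the constraints are. -/
theorem PolyMap.unary_n {I : X → CardInstance} (hI : PolyMap u fun x => (I x).encode) :
    PolyMap u fun x => unary (I x).n := by
  obtain ⟨b, hb⟩ := hI.exists_length_le
  let f (l : List Bool) : List Unit := l.foldr (fun b k => if b then () :: k else []) []
  have hf (I : CardInstance) : f I.encode = unary I.n := by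
    obtain ⟨n, C⟩ := I
    simp only [CardInstance.encode, f]
    induction n with
    | zero => simp [unary]
    | succ n ih => simpa [List.replicate_succ, unary] using ih
  have hf' (l : List Bool) : (f l).length ≤ l.length := by
    induction l with
    | nil => simp [f]
    | cons b l ih =>
      cases b
      · simp [f]
      · simpa [f] using ih
  have := PolyMap.foldr (u := u) (e := fun l : List Unit => l) (y := fun _ => [])
    (step := fun b _ k => if b then () :: k else []) (fun s => by
      cases s
      · exact PolyMap.const _ _
      · exact (PolyMap.refl _).snd.cons _) (PolyMap.const u _) hI b fun x l hl =>
      (hf' l).trans (hl.length_le.trans (hb x))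
  refine cast (congrArg _ (funext fun x => ?_)) this
  exact hf (I x)

/-- Reading from the right, bits are collected in the first component; the separator shifts what has
been collected to the second. -/
theorem PolyMap.ofEncodePair {v w : X → List Bool} (h : PolyMap u fun x => encodePair (v x, w x)) :
    PolyMap u fun x => pairStr (v x) (w x) := by
  obtain ⟨b, hb⟩ := h.exists_length_le
  let f (l : List (Option Bool)) : List Bool × List Bool :=
    l.foldr (fun s p => s.elim ([], p.1) fun b => (b :: p.1, p.2)) ([], [])
  have hf (v w : List Bool) : f (encodePair (v, w)) = (v, w) := by
    have h₁ : f (w.map some) = (w, []) := by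
      induction w with
      | nil => rfl
      | cons b w ih => simp only [f] at ih; simp [f, ih]
    have h₂ : f (none :: w.map some) = ([], w) := by
      simp only [f] at h₁
      simp [f, h₁]
    simp only [f] at h₂
    induction v with
    | nil => exact h₂
    | cons b v ih =>
      simp only [encodePair, f] at ih
      simp [encodePair, f, ih]
  have hf' (l : List (Option Bool)) : (f l).1.length + (f l).2.length ≤ l.length := by
    induction l with
    | nil => simp [f]
    | cons b l ih => cases b <;> simp [f] at ih ⊢ <;> omega
  have := PolyMap.foldr (u := u) (e := fun p : List Bool × List Bool => pairStr p.1 p.2)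
    (y := fun _ => ([], [])) (step := fun s _ p => s.elim ([], p.1) fun b => (b :: p.1, p.2))
    (fun s => by
      have h : PolyMap (fun p : X × (List Bool × List Bool) => pairStr (u p.1) (pairStr p.2.1 p.2.2))
        fun p => pairStr p.2.1 p.2.2 := (PolyMap.refl _).snd
      cases s with
      | none => exact (PolyMap.const _ _).pair h.fst
      | some b => exact (h.fst.cons b).pair h.snd)
    (PolyMap.const u _) h (b + 1) fun x l hl => by
      have h₁ := hb x
      have h₂ := hl.length_le
      have h₃ := hf' l
      simp only [f] at h₃
      simp only [length_pairStr, Polynomial.eval_add, Polynomial.eval_one]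
      omega
  refine cast (congrArg _ (funext fun x => ?_)) this
  have := hf (v x) (w x)
  simp only [f] at this
  rw [this]

theorem PolyMap.encodePair {v w : X → List Bool} (hv : PolyMap u v) (hw : PolyMap u w) :
    PolyMap u fun x => encodePair (v x, w x) := by
  have := (hv.map some).append ((hw.map some).cons none)
  exact this

/-- Truncated subtraction in unary: something is left of `n` after dropping `m` symbols iff `m < n`.
-/
theorem PolyMap.encodeBool_lt {m : X → ℕ} (hm : PolyMap u fun x => unary (m x))
    (hn : PolyMap u fun x => unary (n x)) :
    PolyMap u fun x => Computability.encodeBool (decide (m x < n x)) := by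
  have := (hn.drop hm).cases (PolyMap.const u [false]) fun _ => PolyMap.const u [true]
  refine cast (congrArg _ (funext fun x => ?_)) this
  simp only [unary, List.drop_replicate]
  by_cases h : m x < n x
  · obtain ⟨k, hk⟩ : ∃ k, n x - m x = k + 1 := ⟨n x - m x - 1, by omega⟩
    simp [hk, List.replicate_succ, Computability.encodeBool, h]
  · simp [show n x - m x = 0 by omega, Computability.encodeBool, h]

theorem PolyMap.unary_card {I : X → CardInstance} {s : (x : X) → Finset (Fin (I x).n)}
    (h : PolyMap u fun x => charVector (s x)) : PolyMap u fun x => unary (s x).card := by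
  refine cast (congrArg _ (funext fun x => ?_)) (h.flatMap fun b => if b then [()] else [])
  have key (n : ℕ) (q : Fin n → Prop) [DecidablePred q] :
      (List.ofFn fun v => decide (q v)).flatMap (fun b => if b then [()] else []) =
        unary (Finset.univ.filter q).card := by
    induction n with
    | zero => simp [unary]
    | succ n ih =>
      rw [List.ofFn_succ, List.flatMap_cons, ih, Fin.card_filter_univ_succ]
      by_cases h : q 0 <;> simp [h, unary, List.replicate_succ]
  have := key (I x).n (· ∈ s x)
  simpa [charVector] using this

end PolyMaps

/-! ### The randomized verifier -/

/-- The number of coin flips per weight. -/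
def blockLength (δ : ℕ) (I : CardInstance) : ℕ := I.size.size + δ

/-- The number of coin flips for the choice of a round. -/
def roundBits (D D' : ℕ) (I : CardInstance) : ℕ := D * I.size.size + D'

/-- The input of an online algorithm in a random round against random weights. -/
noncomputable def roundInput (𝒪 : OnlineAlgorithm) (δ D D' : ℕ) (I : CardInstance)
    (r : List Bool) : RoundInput :=
  ⟨I, (List.range (ofBits ((split (split r).1).1.take (roundBits D D' I)))).map
      (randomWeights I.n (blockLength δ I) (split (split r).1).2),
    (split r).2.take (𝒪.numCoins I
      ((List.range (ofBits ((split (split r).1).1.take (roundBits D D' I)))).map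
        (randomWeights I.n (blockLength δ I) (split (split r).1).2)))⟩

/-- Does the algorithm choose a set of size less than `a / b * n` in a random round? -/
noncomputable def verifier (inst : List Bool → CardInstance) (𝒪 : OnlineAlgorithm)
    (δ D D' a b : ℕ) (p : List Bool × List Bool) : Bool :=
  decide (b * (𝒪.act (roundInput 𝒪 δ D D' (inst p.1) p.2)).card < a * (inst p.1).n)

/-- This makes the number of rounds, `2 ^ roundBits`, polynomial in the instance size. -/
theorem two_pow_size_le (m : ℕ) : 2 ^ m.size ≤ 2 * m + 1 := by
  rcases Nat.eq_zero_or_pos m with rfl | hm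
  · simp
  · have h : 0 < m.size := Nat.size_pos.2 hm
    have h' : 2 ^ (m.size - 1) ≤ m := Nat.lt_size.1 (by omega)
    have : 2 ^ m.size = 2 * 2 ^ (m.size - 1) := by
      rw [← pow_succ', Nat.sub_add_cancel h]
    omega

theorem ofBits_lt (l : List Bool) : ofBits l < 2 ^ l.length := by
  induction l with
  | nil => simp [ofBits]
  | cons b l ih =>
    have : ofBits (b :: l) = 2 * ofBits l + b.toNat := rfl
    rw [this, List.length_cons, pow_succ]
    have := Bool.toNat_lt b
    omega

theorem polyTime_verifier {inst : List Bool → CardInstance} {𝒪 : OnlineAlgorithm}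
    (hinst : PolyMap (id : List Bool → List Bool) fun x => (inst x).encode)
    (h𝒪 : PolyTime RoundInput.encode (id : List Bool → List Bool) fun i => charVector (𝒪.act i))
    (δ D D' a b : ℕ) :
    PolyTime encodePair Computability.encodeBool (verifier inst 𝒪 δ D D' a b) := by
  refine PolyMap.polyTime ?_
  have hp : PolyMap encodePair fun p : List Bool × List Bool => pairStr p.1 p.2 :=
    PolyMap.ofEncodePair (PolyMap.refl _)
  have hI : PolyMap encodePair fun p : List Bool × List Bool => (inst p.1).encode :=
    hp.fst.trans (hinst.reindex Prod.fst)
  have hs := hp.snd.split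
  have hs' := hs.fst.split
  have hn := hI.unary_n
  have hk : PolyMap encodePair fun p : List Bool × List Bool => unary (inst p.1).size.size :=
    hI.length.unary_size
  have hj : PolyMap encodePair fun p : List Bool × List Bool => unary (roundBits D D' (inst p.1)) :=
    ((PolyMap.unary_const _ D).unary_mul hk).unary_add (PolyMap.unary_const _ D')
  have hκ : PolyMap encodePair fun p : List Bool × List Bool => unary (blockLength δ (inst p.1)) :=
    hk.unary_add (PolyMap.unary_const _ δ)
  obtain ⟨q, hq⟩ := hI.exists_length_le
  -- The index of the random round is written in unary. It is below `2 ^ roundBits`, a power of two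
  -- whose exponent is linear in the bit length of the instance size.
  have ht := (hs'.fst.take hj).unary_ofBits ((2 * q + 1) ^ D * .C (2 ^ D')) fun p => by
    refine (ofBits_lt _).le.trans ?_
    refine (Nat.pow_le_pow_right two_pos (List.length_take_le ..)).trans ?_
    rw [roundBits, pow_add, mul_comm D, pow_mul]
    simp only [Polynomial.eval_mul, Polynomial.eval_pow, Polynomial.eval_add, Polynomial.eval_ofNat,
      Polynomial.eval_one, Polynomial.eval_C]
    refine Nat.mul_le_mul_right _ (Nat.pow_le_pow_left ((two_pow_size_le _).trans ?_) _)
    have := hq p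
    simp only [CardInstance.size]
    omega
  have hh := PolyMap.history hI hs'.snd hn hκ ht
  have hc := (hs.snd.take (hh.length.unary_eval 𝒪.coinBound)).map RoundSymbol.bit
  have hR : PolyMap encodePair fun p : List Bool × List Bool =>
    (roundInput 𝒪 δ D D' (inst p.1) p.2).encode := hh.append hc
  have hact := hR.trans ((polyMap_of_polyTime h𝒪).reindex fun p : List Bool × List Bool =>
    roundInput 𝒪 δ D D' (inst p.1) p.2)
  have hcard := PolyMap.unary_card (I := fun p : List Bool × List Bool => inst p.1)
    (s := fun p => 𝒪.act (roundInput 𝒪 δ D D' (inst p.1) p.2)) hact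
  exact ((PolyMap.unary_const _ b).unary_mul hcard).encodeBool_lt
    ((PolyMap.unary_const _ a).unary_mul hn)

/-- Run a verifier twice, with independent coin flips. -/
def twice (V : List Bool × List Bool → Bool) (p : List Bool × List Bool) : Bool :=
  V (p.1, (split p.2).1) || V (p.1, (split p.2).2)

theorem polyTime_twice {V : List Bool × List Bool → Bool}
    (hV : PolyTime encodePair Computability.encodeBool V) :
    PolyTime encodePair Computability.encodeBool (twice V) := by
  have hV := polyMap_of_polyTime hV
  refine PolyMap.polyTime ?_
  have hp : PolyMap encodePair fun p : List Bool × List Bool => pairStr p.1 p.2 :=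
    PolyMap.ofEncodePair (PolyMap.refl _)
  have hs := hp.snd.split
  have h₁ := (hp.fst.encodePair hs.fst).trans
    (hV.reindex fun p : List Bool × List Bool => (p.1, (split p.2).1))
  have h₂ := (hp.fst.encodePair hs.snd).trans
    (hV.reindex fun p : List Bool × List Bool => (p.1, (split p.2).2))
  refine cast (congrArg _ (funext fun p => ?_)) (h₁.cases (PolyMap.const _ [])
    (g := fun b p => if b then Computability.encodeBool true else
      Computability.encodeBool (V (p.1, (split p.2).2))) fun b => ?_)
  · simp only [Computability.encodeBool, twice]
    cases V (p.1, (split p.2).1) <;> rfl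
  · cases b
    · exact h₂
    · exact PolyMap.const _ _

/-! ### Averages over coin flips -/

/-- The average of `F` over all bit strings of length `m`. -/
noncomputable def avg : ℕ → (List Bool → ℝ) → ℝ
  | 0, F => F []
  | m + 1, F => (avg m (fun l => F (true :: l)) + avg m fun l => F (false :: l)) / 2

theorem avg_eq_sum (m : ℕ) (F : List Bool → ℝ) :
    avg m F = (∑ ω : Fin m → Bool, F (List.ofFn ω)) / 2 ^ m := by
  induction m generalizing F with
  | zero => simp [avg]
  | succ m ih =>
    rw [avg, ih, ih, ← (Fin.consEquiv fun _ => Bool).sum_comp, Fintype.sum_prod_type]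
    simp only [Fin.consEquiv, Equiv.coe_fn_mk, List.ofFn_succ, Fin.cons_zero, Fin.cons_succ,
      Fintype.sum_bool]
    ring

theorem expect_eq_avg (m : ℕ) (F : List Bool → ℝ) :
    (𝔼 ω : Fin m → Bool, F (List.ofFn ω)) = avg m F := by
  rw [avg_eq_sum, Fintype.expect_eq_sum_div_card]
  simp

theorem acceptProb_eq_avg (V : List Bool × List Bool → Bool) (x : List Bool) (m : ℕ) :
    acceptProb V x m = avg m fun r => if V (x, r) = true then 1 else 0 := by
  rw [avg_eq_sum, acceptProb, Finset.sum_boole, Fintype.card_subtype]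

theorem avg_le_avg {m : ℕ} {F G : List Bool → ℝ} (h : ∀ l, l.length = m → F l ≤ G l) :
    avg m F ≤ avg m G := by
  induction m generalizing F G with
  | zero => exact h [] rfl
  | succ m ih =>
    have h₁ := ih (F := fun l => F (true :: l)) (G := fun l => G (true :: l))
      fun l hl => h _ (by simp [hl])
    have h₂ := ih (F := fun l => F (false :: l)) (G := fun l => G (false :: l))
      fun l hl => h _ (by simp [hl])
    simp only [avg]
    linarith

theorem avg_congr {m : ℕ} {F G : List Bool → ℝ} (h : ∀ l, l.length = m → F l = G l) :
    avg m F = avg m G :=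
  le_antisymm (avg_le_avg fun l hl => (h l hl).le) (avg_le_avg fun l hl => (h l hl).ge)

@[simp] theorem avg_const (m : ℕ) (c : ℝ) : avg m (fun _ => c) = c := by
  induction m with
  | zero => rfl
  | succ m ih => simp [avg, ih]

theorem avg_add (m : ℕ) (F G : List Bool → ℝ) :
    avg m (fun l => F l + G l) = avg m F + avg m G := by
  simp only [avg_eq_sum, Finset.sum_add_distrib, add_div]

theorem avg_sub (m : ℕ) (F G : List Bool → ℝ) :
    avg m (fun l => F l - G l) = avg m F - avg m G := by
  simp only [avg_eq_sum, Finset.sum_sub_distrib, sub_div]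

theorem avg_const_mul (m : ℕ) (c : ℝ) (F : List Bool → ℝ) :
    avg m (fun l => c * F l) = c * avg m F := by
  simp only [avg_eq_sum, ← Finset.mul_sum, mul_div_assoc]

theorem avg_sum {ι : Type} (s : Finset ι) (m : ℕ) (F : ι → List Bool → ℝ) :
    avg m (fun l => ∑ i ∈ s, F i l) = ∑ i ∈ s, avg m (F i) := by
  simp only [avg_eq_sum]
  rw [Finset.sum_comm, Finset.sum_div]

theorem avg_comm (a b : ℕ) (F : List Bool → List Bool → ℝ) :
    avg a (fun u => avg b fun v => F u v) = avg b fun v => avg a fun u => F u v := by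
  simp only [avg_eq_sum, ← Finset.sum_div]
  rw [Finset.sum_comm, div_right_comm]

theorem avg_append (a b : ℕ) (F : List Bool → ℝ) :
    avg (a + b) F = avg a fun u => avg b fun v => F (u ++ v) := by
  induction a generalizing F with
  | zero => simp [avg]
  | succ a ih =>
    rw [Nat.succ_add, avg, ih, ih]
    rfl

theorem avg_take {a m : ℕ} (h : a ≤ m) (F : List Bool → ℝ) :
    avg m (fun l => F (l.take a)) = avg a F := by
  obtain ⟨b, rfl⟩ := Nat.exists_eq_add_of_le h
  rw [avg_append]
  refine avg_congr fun l hl => ?_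
  simp [← hl]

/-- The even and the odd positions of a uniform string are independent and uniform; in this way one
tape supplies several independent sources of randomness. -/
theorem avg_split (m : ℕ) (F : List Bool → List Bool → ℝ) :
    avg (2 * m) (fun r => F (split r).1 (split r).2) = avg m fun u => avg m fun v => F u v := by
  induction m generalizing F with
  | zero => simp [avg, split]
  | succ m ih =>
    have (x y : Bool) := ih fun u v => F (x :: u) (y :: v)
    have h (P Q : List Bool → ℝ) : avg m (fun u => (P u + Q u) / 2) = (avg m P + avg m Q) / 2 := by
      simp only [div_eq_inv_mul, avg_const_mul, avg_add]
    rw [show 2 * (m + 1) = 2 * m + 1 + 1 by ring]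
    simp only [avg, split, this, h]

theorem avg_ofBits (j : ℕ) (g : ℕ → ℝ) :
    avg j (fun l => g (ofBits l)) = (∑ t ∈ Finset.range (2 ^ j), g t) / 2 ^ j := by
  induction j generalizing g with
  | zero => simp [avg, ofBits]
  | succ j ih =>
    have h₁ (l) : ofBits (true :: l) = 2 * ofBits l + 1 := rfl
    have h₂ (l) : ofBits (false :: l) = 2 * ofBits l := rfl
    -- The first flip is the lowest digit, so it decides the parity of the number.
    have h₃ (m : ℕ) : ∑ t ∈ Finset.range (2 * m), g t =
        ∑ t ∈ Finset.range m, g (2 * t + 1) + ∑ t ∈ Finset.range m, g (2 * t) := by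
      induction m with
      | zero => simp
      | succ m ih =>
        rw [Nat.mul_succ, Finset.sum_range_succ, Finset.sum_range_succ, ih, Finset.sum_range_succ,
          Finset.sum_range_succ]
        ring
    simp only [avg, h₁, h₂]
    rw [ih fun t => g (2 * t + 1), ih fun t => g (2 * t), pow_succ', h₃]
    have : (2 : ℝ) ^ (j + 1) = 2 * 2 ^ j := pow_succ' ..
    rw [this]
    field_simp

/-- Disjoint blocks of coin flips are independent; flips after the last block do not matter. -/
theorem avg_prod_blocks (κ : ℕ) (h : ℕ → List Bool → ℝ) {n N : ℕ} (hN : n * κ ≤ N) :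
    avg N (fun e => ∏ v ∈ Finset.range n, h v ((e.drop (v * κ)).take κ)) =
      ∏ v ∈ Finset.range n, avg κ (h v) := by
  induction n generalizing N with
  | zero => simp
  | succ n ih =>
    rw [Nat.succ_mul] at hN
    obtain ⟨b, rfl⟩ := Nat.exists_eq_add_of_le hN
    rw [add_assoc, avg_append, Finset.prod_range_succ, ← ih le_rfl, mul_comm (avg (n * κ) _),
      ← avg_const_mul]
    refine avg_congr fun u hu => ?_
    simp only [Finset.prod_range_succ]
    have h₁ (w : List Bool) : ∏ v ∈ Finset.range n, h v (((u ++ w).drop (v * κ)).take κ) =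
        ∏ v ∈ Finset.range n, h v ((u.drop (v * κ)).take κ) := by
      refine Finset.prod_congr rfl fun v hv => ?_
      have : (v + 1) * κ ≤ n * κ := Nat.mul_le_mul_right _ (Finset.mem_range.1 hv)
      rw [Nat.succ_mul] at this
      rw [List.drop_append_of_le_length (by omega),
        List.take_append_of_le_length (by rw [List.length_drop]; omega)]
    have h₂ (w : List Bool) : (u ++ w).drop (n * κ) = w := by simp [← hu]
    simp only [h₁, h₂]
    rw [avg_const_mul, avg_take (Nat.le_add_right ..), mul_comm]

theorem avg_all (κ : ℕ) (c : ℝ) :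
    avg κ (fun l => if l.all id then c else 1) = 1 - (1 - c) * (1 / 2) ^ κ := by
  induction κ with
  | zero => simp [avg]
  | succ κ ih =>
    simp only [avg, List.all_cons, id, Bool.true_and, Bool.false_and, ih]
    simp
    ring

/-! ### Expected costs under random weights -/

/-- For 0/1 weights the maximum indicates that some element of `x` has weight 1. Its complement is a
product over elements, to which independence applies. -/
theorem minMaxCost_weightOf {n : ℕ} (κ : ℕ) (e : List Bool) (x : Finset (Fin n)) :
    (minMaxCost (fun v : Fin n => weightOf ((e.drop (v * κ)).take κ)) x : ℝ) =
      1 - ∏ v ∈ Finset.range n,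
        if ((e.drop (v * κ)).take κ).all id then (if ∃ h : v < n, ⟨v, h⟩ ∈ x then (0 : ℝ) else 1)
          else 1 := by
  by_cases hx : ∃ v ∈ x, ((e.drop (v * κ)).take κ).all id
  · obtain ⟨v, hv, hall⟩ := hx
    have h₁ : minMaxCost (fun v : Fin n => weightOf ((e.drop (v * κ)).take κ)) x = 1 := by
      refine le_antisymm (Finset.sup_le fun u _ => ?_) ?_
      · unfold weightOf; split_ifs <;> simp
      · refine le_trans ?_ (Finset.le_sup hv)
        simp only [weightOf, if_pos hall, le_refl]
    rw [h₁, Finset.prod_eq_zero (Finset.mem_range.2 v.2)]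
    · simp
    · rw [if_pos hall, if_pos ⟨v.2, hv⟩]
  · push Not at hx
    have h₁ : minMaxCost (fun v : Fin n => weightOf ((e.drop (v * κ)).take κ)) x = 0 := by
      refine le_antisymm (Finset.sup_le fun u hu => ?_) bot_le
      simp only [weightOf, if_neg (hx u hu), le_refl]
    rw [h₁, Finset.prod_eq_one]
    · simp
    · intro v _
      split_ifs with h h'
      · exact absurd h (hx _ h'.2)
      · rfl
      · rfl

/-- The expected cost of a fixed set in one round. -/
theorem avg_minMaxCost {n κ N : ℕ} (hN : n * κ ≤ N) (x : Finset (Fin n)) :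
    avg N (fun e => (minMaxCost (fun v : Fin n => weightOf ((e.drop (v * κ)).take κ)) x : ℝ)) =
      1 - (1 - (1 / 2) ^ κ) ^ x.card := by
  simp only [minMaxCost_weightOf]
  rw [avg_sub, avg_const, avg_prod_blocks κ
    (fun v l => if l.all id then (if ∃ h : v < n, ⟨v, h⟩ ∈ x then (0 : ℝ) else 1) else 1) hN]
  congr 1
  simp only [avg_all]
  rw [← Fin.prod_univ_eq_prod_range
    (fun v => 1 - (1 - if ∃ h : v < n, ⟨v, h⟩ ∈ x then (0 : ℝ) else 1) * (1 / 2) ^ κ) n]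
  rw [← Finset.prod_const, ← Finset.prod_subset (Finset.subset_univ x)]
  · exact Finset.prod_congr rfl fun v hv => by simp [hv]
  · intro v _ hv
    simp [hv]

section Weights

variable {n κ t : ℕ} {u : List Bool}

/-- The first `t` rounds use only the first `t * (n * κ)` flips, so the history before round `t` is
independent of the weights of that round. -/
theorem map_randomWeights_append (hu : t * (n * κ) ≤ u.length) (v : List Bool) :
    (List.range t).map (randomWeights n κ (u ++ v)) = (List.range t).map (randomWeights n κ u) := by
  refine List.map_congr_left fun i hi => funext fun j => ?_
  have hi : i + 1 ≤ t := List.mem_range.1 hi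
  have h : (i * n + j + 1) * κ ≤ u.length := by
    refine le_trans ?_ hu
    rw [← mul_assoc]
    refine Nat.mul_le_mul_right _ (le_trans ?_ (Nat.mul_le_mul_right n hi))
    rw [Nat.succ_mul]
    omega
  rw [Nat.succ_mul] at h
  unfold randomWeights
  rw [List.drop_append_of_le_length (by omega),
    List.take_append_of_le_length (by rw [List.length_drop]; omega)]

theorem randomWeights_append (hu : u.length = t * (n * κ)) (v : List Bool) :
    randomWeights n κ (u ++ v) t = fun j : Fin n => weightOf ((v.drop (j * κ)).take κ) := by
  funext j
  unfold randomWeights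
  rw [show (t * n + j) * κ = u.length + j * κ by rw [hu]; ring, List.drop_append,
    List.drop_of_length_le (Nat.le_add_right _ _), Nat.add_sub_cancel_left, List.nil_append]

theorem randomWeights_le_one (n κ : ℕ) (e : List Bool) (t : ℕ) (j : Fin n) :
    randomWeights n κ e t j ≤ 1 := by
  unfold randomWeights weightOf
  split_ifs <;> simp

/-- The expected cost of a fixed set in one round. -/
theorem avg_minMaxCost_randomWeights {M : ℕ} (hM : (t + 1) * (n * κ) ≤ M) (x : Finset (Fin n)) :
    avg M (fun e => (minMaxCost (randomWeights n κ e t) x : ℝ)) =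
      1 - (1 - (1 / 2) ^ κ) ^ x.card := by
  rw [Nat.succ_mul] at hM
  obtain ⟨N, rfl⟩ := Nat.exists_eq_add_of_le ((Nat.le_add_right _ _).trans hM)
  rw [avg_append]
  refine (avg_congr fun u hu => ?_).trans (avg_const _ _)
  simp only [randomWeights_append hu]
  exact avg_minMaxCost (by omega) x

/-- The expected cost of an algorithm in one round. -/
theorem le_avg_minMaxCost (𝒪 : OnlineAlgorithm) (I : CardInstance) {M : ℕ}
    (hM : (t + 1) * (I.n * κ) ≤ M) (L : ℕ) (Q : ℕ → Prop) [DecidablePred Q] {β : ℝ}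
    (hβ : ∀ m, ¬ Q m → β ≤ 1 - (1 - (1 / 2) ^ κ) ^ m) :
    β * avg M (fun e => avg L fun o =>
        if Q (𝒪.action I (randomWeights I.n κ e) o t).card then 0 else 1) ≤
      avg M fun e => avg L fun o => (minMaxCost (randomWeights I.n κ e t)
        (𝒪.action I (randomWeights I.n κ e) o t) : ℝ) := by
  rw [Nat.succ_mul] at hM
  obtain ⟨N, rfl⟩ := Nat.exists_eq_add_of_le ((Nat.le_add_right _ _).trans hM)
  rw [avg_append, avg_append, ← avg_const_mul]
  refine avg_le_avg fun u hu => ?_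
  let act (h : List (Fin I.n → ℚ≥0)) (o : List Bool) : Finset (Fin I.n) :=
    𝒪.act ⟨I, h, o.take (𝒪.numCoins I h)⟩
  have hact (v o : List Bool) : 𝒪.action I (randomWeights I.n κ (u ++ v)) o t =
      act ((List.range t).map (randomWeights I.n κ u)) o := by
    rw [← map_randomWeights_append hu.ge v]
    rfl
  simp only [hact, randomWeights_append hu, avg_const]
  -- With the past flips `u` and the algorithm's flips `o` fixed, the action is a fixed set; only
  -- then is the average over the fresh weights taken.
  rw [avg_comm, ← avg_const_mul]
  refine avg_le_avg fun o _ => ?_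
  rw [avg_minMaxCost (by omega)]
  split_ifs with h
  · rw [mul_zero, sub_nonneg]
    exact pow_le_one₀ (sub_nonneg.2 (pow_le_one₀ (by norm_num) (by norm_num))) (by simp)
  · rw [mul_one]
    exact hβ _ h

end Weights

/-! ### From small regret to few large actions -/

theorem length_encodeHistory_mono (I : CardInstance) (w : ℕ → Fin I.n → ℚ≥0) {t T : ℕ} (h : t ≤ T) :
    (encodeHistory I ((List.range t).map w)).length ≤
      (encodeHistory I ((List.range T).map w)).length := by
  obtain ⟨d, rfl⟩ := Nat.exists_eq_add_of_le h
  simp only [encodeHistory, List.range_add, List.map_append, List.flatMap_append,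
    List.length_append, List.length_cons]
  omega

theorem numCoins_mono (𝒪 : OnlineAlgorithm) (I : CardInstance) (w : ℕ → Fin I.n → ℚ≥0) {t T : ℕ}
    (h : t ≤ T) :
    𝒪.numCoins I ((List.range t).map w) ≤ 𝒪.numCoins I ((List.range T).map w) :=
  eval_mono _ (length_encodeHistory_mono I w h)

/-- The expected cost of an algorithm in terms of its expected regret; the tape may be longer than
necessary. -/
theorem avg_totalCost (𝒪 : OnlineAlgorithm) (P : CardMinProblem) (α : ℝ) (I : CardInstance)
    (w : ℕ → Fin I.n → ℚ≥0) (T : ℕ) {L : ℕ} (hL : 𝒪.numCoins I ((List.range T).map w) ≤ L) :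
    (avg L fun o => 𝒪.totalCost I w o T) =
      α * P.bestStatic I w T + 𝒪.expectedRegret P α I w T := by
  unfold OnlineAlgorithm.expectedRegret
  rw [expect_eq_avg _ fun o => 𝒪.totalCost I w o T - α * P.bestStatic I w T, avg_sub, avg_const,
    add_sub_cancel, ← avg_take hL]
  refine avg_congr fun o _ => ?_
  unfold OnlineAlgorithm.totalCost OnlineAlgorithm.action
  refine Finset.sum_congr rfl fun t ht => ?_
  -- Earlier rounds read shorter initial segments, so cutting the tape to the length for `T` rounds
  -- changes no action.
  rw [List.take_take, min_eq_left (numCoins_mono 𝒪 I w (Finset.mem_range.1 ht).le)]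

theorem bestStatic_nonneg (P : CardMinProblem) (I : CardInstance) (w : ℕ → Fin I.n → ℚ≥0) (T : ℕ) :
    0 ≤ P.bestStatic I w T := by
  refine Real.sInf_nonneg ?_
  rintro _ ⟨x, -, rfl⟩
  exact Finset.sum_nonneg fun _ _ => NNRat.cast_nonneg _

theorem bestStatic_le (P : CardMinProblem) (I : CardInstance) (w : ℕ → Fin I.n → ℚ≥0) (T : ℕ)
    {x : Finset (Fin I.n)} (hx : P.Feasible I x) :
    P.bestStatic I w T ≤ ∑ t ∈ Finset.range T, (minMaxCost (w t) x : ℝ) := by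
  refine csInf_le ⟨0, ?_⟩ ⟨x, hx, rfl⟩
  rintro _ ⟨x, -, rfl⟩
  exact Finset.sum_nonneg fun _ _ => NNRat.cast_nonneg _

/-- A vanishing regret algorithm cannot choose large sets too often. -/
theorem sum_avg_large_le (𝒪 : OnlineAlgorithm) (P : CardMinProblem) {α ε : ℝ} (I : CardInstance)
    {T κ M L : ℕ} (hregret : ∀ w : ℕ → Fin I.n → ℚ≥0, (∀ t u, w t u ≤ 1) →
      𝒪.expectedRegret P α I w T ≤ ε)
    (hM : T * (I.n * κ) ≤ M)
    (hL : ∀ e, 𝒪.numCoins I ((List.range T).map (randomWeights I.n κ e)) ≤ L)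
    {x : Finset (Fin I.n)} (hx : P.Feasible I x) (Q : ℕ → Prop) [DecidablePred Q] {β : ℝ}
    (hβ : ∀ m, ¬ Q m → β ≤ 1 - (1 - (1 / 2) ^ κ) ^ m) :
    β * ∑ t ∈ Finset.range T, avg M (fun e => avg L fun o =>
        if Q (𝒪.action I (randomWeights I.n κ e) o t).card then 0 else 1) ≤
      max α 0 * (T * ((1 / 2) ^ κ * x.card)) + ε := by
  have hM' {t : ℕ} (ht : t ∈ Finset.range T) : (t + 1) * (I.n * κ) ≤ M :=
    (Nat.mul_le_mul_right _ (Finset.mem_range.1 ht)).trans hM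
  calc _ = ∑ t ∈ Finset.range T, β * avg M (fun e => avg L fun o =>
        if Q (𝒪.action I (randomWeights I.n κ e) o t).card then 0 else 1) := Finset.mul_sum ..
    _ ≤ ∑ t ∈ Finset.range T, avg M fun e => avg L fun o =>
        (minMaxCost (randomWeights I.n κ e t)
          (𝒪.action I (randomWeights I.n κ e) o t) : ℝ) :=
      Finset.sum_le_sum fun t ht => le_avg_minMaxCost 𝒪 I (hM' ht) L Q hβ
    _ = avg M fun e => avg L fun o => 𝒪.totalCost I (randomWeights I.n κ e) o T := by
      simp only [OnlineAlgorithm.totalCost, avg_sum]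
    _ ≤ avg M fun e => max α 0 * (∑ t ∈ Finset.range T,
        (minMaxCost (randomWeights I.n κ e t) x : ℝ)) + ε := by
      refine avg_le_avg fun e _ => ?_
      rw [avg_totalCost 𝒪 P α I _ T (hL e)]
      refine add_le_add ?_ (hregret _ (randomWeights_le_one _ _ _))
      -- A negative `α` would reverse the comparison with the cost of `x`; hence `max α 0`.
      exact (mul_le_mul_of_nonneg_right (le_max_left α 0) (bestStatic_nonneg ..)).trans
        (mul_le_mul_of_nonneg_left (bestStatic_le P I _ T hx) (le_max_right α 0))
    _ = max α 0 * (∑ t ∈ Finset.range T, (1 - (1 - (1 / 2) ^ κ) ^ x.card)) + ε := by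
      rw [avg_add, avg_const, avg_const_mul, avg_sum]
      congr 2
      exact Finset.sum_congr rfl fun t ht => avg_minMaxCost_randomWeights (hM' ht) x
    _ ≤ _ := by
      rw [Finset.sum_const, Finset.card_range, nsmul_eq_mul]
      gcongr
      -- Bernoulli's inequality: a set of size `m` costs at most `m * p` on average.
      have := one_add_mul_le_pow (a := -(1 / 2 : ℝ) ^ κ)
        (by linarith [pow_le_one₀ (n := κ) (by norm_num : (0 : ℝ) ≤ 1 / 2) (by norm_num)]) x.card
      rw [← sub_eq_add_neg] at this
      linarith

/-! ### Amplification -/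

/-- The doubled verifier rejects iff two independent runs both reject. -/
theorem acceptProb_twice (V : List Bool × List Bool → Bool) (x : List Bool) (m : ℕ) :
    1 - acceptProb (twice V) x (2 * m) = (1 - acceptProb V x m) ^ 2 := by
  have h : (1 - acceptProb V x m) = avg m fun r => 1 - if V (x, r) = true then (1 : ℝ) else 0 := by
    rw [acceptProb_eq_avg, avg_sub, avg_const]
  rw [sq, h, acceptProb_eq_avg]
  nth_rw 1 [← avg_const (2 * m) 1]
  rw [← avg_sub, ← avg_const_mul]
  refine Eq.trans (avg_congr fun r _ => ?_) ((avg_split m fun r₁ r₂ =>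
    (1 - if V (x, r₂) = true then (1 : ℝ) else 0) *
      (1 - if V (x, r₁) = true then (1 : ℝ) else 0)).trans ?_)
  · simp only [twice, Bool.or_eq_true]
    by_cases h₁ : V (x, (split r).1) = true <;> by_cases h₂ : V (x, (split r).2) = true <;>
      simp [h₁, h₂]
  · rw [avg_comm]
    simp only [avg_const_mul, mul_comm]

/-- A constant acceptance probability suffices for membership in RP. -/
theorem inRP_of_acceptProb {Q : PromiseProblem} {V : List Bool × List Bool → Bool}
    (hV : PolyTime encodePair Computability.encodeBool V) (p : Polynomial ℕ) {ε : ℝ} (hε : 0 < ε)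
    (hyes : ∀ x ∈ Q.yes, ε ≤ acceptProb V x (p.eval x.length))
    (hno : ∀ x ∈ Q.no, acceptProb V x (p.eval x.length) = 0) : Q.InRP := by
  have key (i : ℕ) (x : List Bool) : PolyTime encodePair Computability.encodeBool (twice^[i] V) ∧
      1 - acceptProb (twice^[i] V) x ((.C (2 ^ i) * p : Polynomial ℕ).eval x.length) =
        (1 - acceptProb V x (p.eval x.length)) ^ (2 ^ i) := by
    induction i with
    | zero => exact ⟨hV, by simp⟩
    | succ i ih =>
      rw [iterate_succ_apply']
      refine ⟨polyTime_twice ih.1, ?_⟩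
      rw [pow_succ 2 i, pow_mul, ← ih.2, ← acceptProb_twice]
      simp only [Polynomial.eval_mul, Polynomial.eval_C]
      rw [mul_comm _ 2, mul_assoc]
  -- `N` doublings amount to `2 ^ N ≥ N` independent runs.
  obtain ⟨N, hN⟩ := exists_pow_lt_of_lt_one (by norm_num : (0 : ℝ) < 1 / 2)
    (by linarith : 1 - ε < 1)
  refine ⟨twice^[N] V, .C (2 ^ N) * p, (key N []).1, fun x hx => ?_, fun x hx => ?_⟩
  · have h₁ := (key N x).2
    have h₂ : (1 - acceptProb V x (p.eval x.length)) ^ (2 ^ N) ≤ (1 - ε) ^ N := by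
      have h₃ : acceptProb V x (p.eval x.length) ≤ 1 := by
        rw [acceptProb_eq_avg]
        refine (avg_le_avg fun l _ => ?_).trans (avg_const _ 1).le
        split_ifs <;> norm_num
      refine (pow_le_pow_of_le_one (by linarith) (by linarith [hyes x hx])
        Nat.lt_two_pow_self.le).trans (pow_le_pow_left₀ (by linarith) (by linarith [hyes x hx]) _)
    linarith
  · have := (key N x).2
    rw [hno x hx] at this
    simpa using this

/-- Coin flips serve as certificates: positive acceptance probability yields an accepting sequence,
zero probability excludes one. -/
theorem classRP_subset_classNP : classRP ⊆ classNP := by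
  rintro L ⟨V, p, hV, hyes, hno⟩
  refine ⟨V, p, hV, fun x hx => ?_, fun x hx w hw => ?_⟩
  · have h := hyes x hx
    rcases isEmpty_or_nonempty {r : Fin (p.eval x.length) → Bool // V (x, List.ofFn r) = true} with
      h' | ⟨r, hr⟩
    · rw [acceptProb, Fintype.card_eq_zero] at h
      norm_num at h
    · exact ⟨List.ofFn r, List.length_ofFn, hr⟩
  · have h := hno x hx
    rw [acceptProb, div_eq_zero_iff, or_iff_left (by positivity), Nat.cast_eq_zero,
      Fintype.card_eq_zero_iff] at h
    refine eq_false_of_ne_true fun h' => h.false ⟨fun i => w.get (i.cast hw.symm), ?_⟩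
    convert h'
    refine List.ext_get (by simp [hw]) fun i h₁ h₂ => by simp

/-! ### The acceptance probability of the verifier -/

/-- A tape of length `4 * M` is split into `M` flips for the round, `M` for the weights and `2 * M`
for the algorithm. The number of rounds is a power of two, so an initial segment of the first part
gives a uniform round. -/
theorem acceptProb_verifier (inst : List Bool → CardInstance) (𝒪 : OnlineAlgorithm)
    (δ D D' a b : ℕ) (x : List Bool) {M : ℕ} (hM : roundBits D D' (inst x) ≤ M) :
    acceptProb (verifier inst 𝒪 δ D D' a b) x (2 * (2 * M)) =
      (∑ t ∈ Finset.range (2 ^ roundBits D D' (inst x)), avg M fun e => avg (2 * M) fun o =>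
        if b * (𝒪.action (inst x) (randomWeights (inst x).n (blockLength δ (inst x)) e) o t).card <
          a * (inst x).n then 1 else 0) / 2 ^ roundBits D D' (inst x) := by
  rw [acceptProb_eq_avg]
  let F (t : ℕ) (e o : List Bool) : ℝ :=
    if b * (𝒪.action (inst x) (randomWeights (inst x).n (blockLength δ (inst x)) e) o t).card <
      a * (inst x).n then 1 else 0
  have h (r : List Bool) : (if verifier inst 𝒪 δ D D' a b (x, r) = true then (1 : ℝ) else 0) =
      F (ofBits ((split (split r).1).1.take (roundBits D D' (inst x)))) (split (split r).1).2
        (split r).2 := by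
    simp only [verifier, decide_eq_true_eq]
    rfl
  simp only [h]
  rw [avg_split (2 * M) fun u o => F (ofBits ((split u).1.take (roundBits D D' (inst x))))
    (split u).2 o, avg_split M fun c e => avg (2 * M) fun o =>
      F (ofBits (c.take (roundBits D D' (inst x)))) e o, avg_take hM
      (fun c => avg M fun e => avg (2 * M) fun o => F (ofBits c) e o),
    avg_ofBits _ fun t => avg M fun e => avg (2 * M) fun o => F t e o]

/-! ### Choice of the parameters and their estimates -/

theorem exists_eval_le_two_pow (p : Polynomial ℕ) :
    ∃ d d' : ℕ, ∀ s k : ℕ, s ≤ 2 ^ k → p.eval s ≤ 2 ^ (d * k + d') := by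
  induction p using Polynomial.induction_on' with
  | add p q hp hq =>
    obtain ⟨d, d', hp⟩ := hp
    obtain ⟨e, e', hq⟩ := hq
    refine ⟨d + e, d' + e' + 1, fun s k h => ?_⟩
    have h₁ := hp s k h
    have h₂ := hq s k h
    rw [Polynomial.eval_add,
      show (d + e) * k + (d' + e' + 1) = (d * k + d') + (e * k + e') + 1 by ring, pow_succ, pow_add]
    have h₃ := Nat.one_le_two_pow (n := d * k + d')
    have h₄ := Nat.one_le_two_pow (n := e * k + e')
    generalize 2 ^ (d * k + d') = y at *
    generalize 2 ^ (e * k + e') = z at *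
    nlinarith [Nat.mul_le_mul h₃ (le_refl z), Nat.mul_le_mul (le_refl y) h₄]
  | monomial n c =>
    refine ⟨n, c, fun s k h => ?_⟩
    rw [Polynomial.eval_monomial, pow_add, mul_comm c, mul_comm n, pow_mul]
    exact Nat.mul_le_mul (Nat.pow_le_pow_left h n) Nat.lt_two_pow_self.le

/-- With polynomially many rounds the regret is small. -/
theorem exists_rounds (p : Polynomial ℕ) {c : ℝ} (hc : c < 1) (δ : ℕ) {ε : ℝ} (hε : 0 < ε) :
    ∃ D D' : ℕ, ∀ s k : ℕ, s ≤ 2 ^ k →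
      2 * ((p.eval s : ℕ) : ℝ) * ((2 ^ (D * k + D') : ℕ) : ℝ) ^ c * 2 ^ (k + δ) ≤
        ε * 2 ^ (D * k + D') := by
  obtain ⟨d, d', hd⟩ := exists_eval_le_two_pow p
  obtain ⟨N, hN⟩ := pow_unbounded_of_one_lt ε⁻¹ (by norm_num : (1 : ℝ) < 2)
  -- It is enough that `T ^ (1 - c)` beats the polynomial, the factor `2 ^ (k + δ) * 2` and `ε⁻¹ < 2
  -- ^ N`. Comparing exponents of 2, `D` handles the multiples of `k` and `D'` the constants.
  obtain ⟨D, hD⟩ := exists_nat_ge ((d + 1) / (1 - c))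
  obtain ⟨D', hD'⟩ := exists_nat_ge ((d' + δ + 1 + N) / (1 - c))
  refine ⟨D, D', fun s k h => ?_⟩
  rw [div_le_iff₀ (by linarith)] at hD hD'
  have hp : ((p.eval s : ℕ) : ℝ) ≤ 2 ^ (d * k + d') := by exact_mod_cast hd s k h
  set T : ℝ := 2 ^ (D * k + D') with hT
  have hT₀ : 0 < T := by positivity
  have h₁ : (2 : ℝ) ^ (d * k + d' + (k + δ) + 1 + N) ≤ T ^ (1 - c) := by
    rw [hT, ← Real.rpow_natCast 2 (D * k + D'), ← Real.rpow_mul (by norm_num), ← Real.rpow_natCast]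
    refine Real.rpow_le_rpow_of_exponent_le (by norm_num) ?_
    push_cast
    nlinarith [mul_le_mul_of_nonneg_right hD (Nat.cast_nonneg (α := ℝ) k)]
  have h₂ : T = T ^ c * T ^ (1 - c) := by
    rw [← Real.rpow_add hT₀, add_sub_cancel, Real.rpow_one]
  have h₃ : 1 ≤ ε * 2 ^ N := by
    rw [inv_lt_iff_one_lt_mul₀ hε] at hN
    linarith
  have h₄ : ((2 ^ (D * k + D') : ℕ) : ℝ) = T := by simp [hT]
  rw [h₄]
  calc 2 * ((p.eval s : ℕ) : ℝ) * T ^ c * 2 ^ (k + δ)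
      ≤ 2 * 2 ^ (d * k + d') * T ^ c * 2 ^ (k + δ) * (ε * 2 ^ N) := by
        refine (le_mul_of_one_le_right (by positivity) h₃).trans' ?_
        gcongr
    _ = ε * (T ^ c * 2 ^ (d * k + d' + (k + δ) + 1 + N)) := by ring
    _ ≤ ε * (T ^ c * T ^ (1 - c)) := by gcongr
    _ = ε * T := by rw [← h₂]

/-- A large set is expensive. -/
theorem le_one_sub_pow {p q η n m : ℝ} (k : ℕ) (hm : m = k) (hp : 0 ≤ p) (hp' : p ≤ 1)
    (hq : 0 ≤ q) (hq' : q ≤ 1) (hη : n * p ≤ η) (hn : 0 ≤ n) (h : q * n ≤ m) :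
    q * n * p / (1 + η) ≤ 1 - (1 - p) ^ k := by
  subst hm
  have hη₀ : 0 ≤ η := (mul_nonneg hn hp).trans hη
  -- Bernoulli for `(1 + p) ^ k`, together with `(1 - p) * (1 + p) ≤ 1`; this gives the lower bound
  -- `k * p / (1 + k * p)` on the cost.
  have h₁ : (1 - p) ^ k * (1 + k * p) ≤ 1 := by
    have h₂ : 1 + k * p ≤ (1 + p) ^ k := one_add_mul_le_pow (by linarith) k
    calc (1 - p) ^ k * (1 + k * p) ≤ (1 - p) ^ k * (1 + p) ^ k := by
          refine mul_le_mul_of_nonneg_left h₂ (pow_nonneg (by linarith) _)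
      _ = (1 - p ^ 2) ^ k := by rw [← mul_pow]; ring
      _ ≤ 1 := pow_le_one₀ (by nlinarith) (by nlinarith)
  have hkp : 0 ≤ k * p := by positivity
  have h₂ : (1 - p) ^ k ≤ 1 / (1 + k * p) := by rwa [le_div_iff₀ (by positivity)]
  have h₃ : q * n * p / (1 + η) ≤ 1 - 1 / (1 + k * p) := by
    rw [one_sub_div (by positivity), div_le_div_iff₀ (by positivity) (by positivity)]
    have h₄ : q * n * p ≤ k * p := mul_le_mul_of_nonneg_right h hp
    have h₅ : q * (n * p) ≤ η := by nlinarith [mul_nonneg hn hp]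
    nlinarith [mul_le_mul_of_nonneg_right h₅ hkp]
  linarith

/-- A polynomial bound on the number of coin flips of the verifier. -/
theorem exists_coins (𝒪 : OnlineAlgorithm) (δ D D' : ℕ) :
    ∃ p : Polynomial ℕ, ∀ I : CardInstance, roundBits D D' I ≤ p.eval I.size ∧
      2 ^ roundBits D D' I * (I.n * blockLength δ I) ≤ p.eval I.size ∧
      ∀ e, 𝒪.numCoins I ((List.range (2 ^ roundBits D D' I)).map
        (randomWeights I.n (blockLength δ I) e)) ≤ p.eval I.size := by
  let T : Polynomial ℕ := (2 * .X + 1) ^ D * .C (2 ^ D')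
  refine ⟨(.C D * .X + .C D') + T * (.X * (.X + .C δ)) +
    𝒪.coinBound.comp (.X + 1 + T * (4 * .X + 1)), fun I => ?_⟩
  have hn : I.n ≤ I.size := by
    simp only [CardInstance.size, CardInstance.encode, List.length_append, List.length_replicate]
    omega
  have hsize : I.size.size ≤ I.size := Nat.size_le.2 Nat.lt_two_pow_self
  have hT : 2 ^ roundBits D D' I ≤ T.eval I.size := by
    simp only [T, Polynomial.eval_mul, Polynomial.eval_pow, Polynomial.eval_add,
      Polynomial.eval_one, Polynomial.eval_X, Polynomial.eval_C, Polynomial.eval_ofNat]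
    rw [roundBits, pow_add, mul_comm D, pow_mul]
    exact Nat.mul_le_mul_right _ (Nat.pow_le_pow_left (two_pow_size_le _) _)
  have h₁ : roundBits D D' I ≤ D * I.size + D' :=
    Nat.add_le_add_right (Nat.mul_le_mul_left _ hsize) _
  have h₂ : 2 ^ roundBits D D' I * (I.n * blockLength δ I) ≤
      T.eval I.size * (I.size * (I.size + δ)) :=
    Nat.mul_le_mul hT (Nat.mul_le_mul hn (Nat.add_le_add_right hsize _))
  have h₃ (e : List Bool) : 𝒪.numCoins I ((List.range (2 ^ roundBits D D' I)).map
      (randomWeights I.n (blockLength δ I) e)) ≤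
        𝒪.coinBound.eval (I.size + 1 + T.eval I.size * (4 * I.size + 1)) := by
    refine eval_mono _ ?_
    simp only [encodeHistory, List.length_append, List.length_map, List.length_cons,
      List.flatMap_map, encodeWeights_randomWeights]
    have h := length_flatMap_range_le
      (fun i => roundStr I.n (blockLength δ I) (e.drop (i * (I.n * blockLength δ I))))
      (4 * I.n + 1) (2 ^ roundBits D D' I) fun i => length_roundStr_le ..
    have h' : 2 ^ roundBits D D' I * (4 * I.n + 1) ≤ T.eval I.size * (4 * I.size + 1) :=
      Nat.mul_le_mul hT (by omega)
    have : I.size = I.encode.length := rfl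
    omega
  simp only [Polynomial.eval_add, Polynomial.eval_mul, Polynomial.eval_comp, Polynomial.eval_one,
    Polynomial.eval_X, Polynomial.eval_C, Polynomial.eval_ofNat]
  exact ⟨by omega, by omega, fun e => (h₃ e).trans (Nat.le_add_left _ _)⟩

/-! ### Soundness and completeness of the verifier -/

/-- The verifier never accepts if all feasible solutions are large. -/
theorem acceptProb_verifier_eq_zero {𝒪 : OnlineAlgorithm} {inst : List Bool → CardInstance}
    {P : CardMinProblem} {δ D D' a b : ℕ} {x : List Bool} {M : ℕ}
    (hM : roundBits D D' (inst x) ≤ M)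
    (hL : ∀ e, 𝒪.numCoins (inst x) ((List.range (2 ^ roundBits D D' (inst x))).map
      (randomWeights (inst x).n (blockLength δ (inst x)) e)) ≤ M)
    (hfeas : ∀ (h : List (Fin (inst x).n → ℚ≥0)) (ω : List Bool),
      ω.length = 𝒪.numCoins (inst x) h → P.Feasible (inst x) (𝒪.act ⟨inst x, h, ω⟩))
    (hlarge : ∀ y, P.Feasible (inst x) y → a * (inst x).n ≤ b * y.card) :
    acceptProb (verifier inst 𝒪 δ D D' a b) x (2 * (2 * M)) = 0 := by
  rw [acceptProb_verifier inst 𝒪 δ D D' a b x hM, Finset.sum_eq_zero, zero_div]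
  intro t ht
  refine (avg_congr fun e _ => (avg_congr fun o ho => ?_).trans (avg_const _ 0)).trans
    (avg_const _ 0)
  refine if_neg (Nat.not_lt.2 (hlarge _ (hfeas _ _ ?_)))
  rw [List.length_take, ho, min_eq_left]
  -- Feasibility is only promised when the algorithm gets its full number of flips, so the tape must
  -- be long enough for round `t`.
  have := (numCoins_mono 𝒪 (inst x) (randomWeights (inst x).n (blockLength δ (inst x)) e)
    (Finset.mem_range.1 ht).le).trans (hL e)
  omega

/-- After division by `q * n * p / (1 + η)`, the comparison with the small solution contributes at
most `(1 + γ) / 2 * T` and the regret at most `(1 - γ) / 4 * T`; these add up to `(3 + γ) / 4 * T`.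
-/
theorem le_of_regret {S q n p η α k γ R T : ℝ} (hq : 0 < q) (hn : 1 ≤ n) (hp : 0 < p)
    (hη : 0 ≤ η) (hη' : η ≤ 1) (hγ : γ < 1) (hηγ : (1 + η) * γ ≤ (1 + γ) / 2) (hT : 0 ≤ T)
    (hk : α * k ≤ γ * (q * n)) (hR : 0 ≤ R) (hR' : 2 * R ≤ q * (1 - γ) / 4 * T * p)
    (h : q * n * p / (1 + η) * S ≤ α * (T * (p * k)) + R) : S ≤ (3 + γ) / 4 * T := by
  have hqnp : 0 < q * n * p := by positivity
  rw [div_mul_eq_mul_div, div_le_iff₀ (by positivity)] at h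
  have h₁ : α * (T * (p * k)) * (1 + η) ≤ (1 + γ) / 2 * T * (q * n * p) :=
    calc α * (T * (p * k)) * (1 + η) = α * k * (T * p * (1 + η)) := by ring
      _ ≤ γ * (q * n) * (T * p * (1 + η)) := by gcongr
      _ = (1 + η) * γ * (T * (q * n * p)) := by ring
      _ ≤ (1 + γ) / 2 * (T * (q * n * p)) := by gcongr
      _ = _ := by ring
  have h₂ : R * (1 + η) ≤ (1 - γ) / 4 * T * (q * n * p) :=
    calc R * (1 + η) ≤ R * 2 := by gcongr; linarith
      _ ≤ q * (1 - γ) / 4 * T * p * 1 := by linarith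
      _ ≤ q * (1 - γ) / 4 * T * p * n := by
        have : 0 ≤ 1 - γ := by linarith
        gcongr
      _ = _ := by ring
  refine le_of_mul_le_mul_left ?_ hqnp
  linarith

/-- The verifier accepts with constant probability if there is a small feasible solution. -/
theorem le_acceptProb_verifier {𝒪 : OnlineAlgorithm} {inst : List Bool → CardInstance}
    {P : CardMinProblem} {δ D D' a b : ℕ} {x : List Bool} {M : ℕ} {α γ R : ℝ}
    (hM : roundBits D D' (inst x) ≤ M)
    (hM' : 2 ^ roundBits D D' (inst x) * ((inst x).n * blockLength δ (inst x)) ≤ M)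
    (hL : ∀ e, 𝒪.numCoins (inst x) ((List.range (2 ^ roundBits D D' (inst x))).map
      (randomWeights (inst x).n (blockLength δ (inst x)) e)) ≤ M)
    (ha : 0 < a) (hab : a ≤ b) (hn : 0 < (inst x).n) (hγ : γ < 1)
    (hδ : (1 + (1 / 2) ^ δ) * γ ≤ (1 + γ) / 2)
    (hregret : ∀ w : ℕ → Fin (inst x).n → ℚ≥0, (∀ t u, w t u ≤ 1) →
      𝒪.expectedRegret P α (inst x) w (2 ^ roundBits D D' (inst x)) ≤ R) (hR : 0 ≤ R)
    (hR' : 2 * R * 2 ^ blockLength δ (inst x) ≤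
      (a / b : ℝ) * (1 - γ) / 4 * 2 ^ roundBits D D' (inst x))
    {y : Finset (Fin (inst x).n)} (hy : P.Feasible (inst x) y)
    (hy' : max α 0 * y.card ≤ γ * ((a / b : ℝ) * (inst x).n)) :
    (1 - γ) / 4 ≤ acceptProb (verifier inst 𝒪 δ D D' a b) x (2 * (2 * M)) := by
  have hb : (0 : ℝ) < b := by exact_mod_cast ha.trans_le hab
  have ha' : (0 : ℝ) < a := by exact_mod_cast ha
  have hn' : (1 : ℝ) ≤ (inst x).n := by exact_mod_cast hn
  have hns : ((inst x).n : ℝ) ≤ 2 ^ (inst x).size.size := by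
    have h₁ : (inst x).n ≤ (inst x).size := by
      simp only [CardInstance.size, CardInstance.encode, List.length_append,
        List.length_replicate]
      omega
    exact_mod_cast h₁.trans (Nat.lt_size_self _).le
  -- The block length exceeds the bit length of the instance size by `δ`, so the expected number of
  -- elements of weight 1 in a round is at most `η = 2^(-δ)`.
  have hnp : (inst x).n * (1 / 2 : ℝ) ^ blockLength δ (inst x) ≤ (1 / 2) ^ δ := by
    rw [blockLength, pow_add, ← mul_assoc]
    refine mul_le_of_le_one_left (by positivity) ?_
    rw [one_div, inv_pow, ← div_eq_mul_inv]
    exact div_le_one_of_le₀ hns (by positivity)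
  have h := sum_avg_large_le 𝒪 P (inst x) (L := 2 * M) hregret hM'
    (fun e => (hL e).trans (by omega)) hy (fun m => b * m < a * (inst x).n)
    (β := (a / b : ℝ) * (inst x).n * (1 / 2) ^ blockLength δ (inst x) / (1 + (1 / 2) ^ δ))
    fun m hm => le_one_sub_pow m rfl (by positivity)
      (pow_le_one₀ (by norm_num) (by norm_num)) (by positivity)
      (div_le_one_of_le₀ (by exact_mod_cast hab) hb.le) hnp (by positivity) (by
        rw [div_mul_eq_mul_div, div_le_iff₀ hb, mul_comm (m : ℝ)]
        exact_mod_cast Nat.not_lt.1 hm)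
  have h' := le_of_regret (by positivity) hn' (by positivity) (by positivity)
    (pow_le_one₀ (by norm_num) (by norm_num)) hγ hδ (by positivity) hy' hR (by
      rw [one_div, inv_pow, ← div_eq_mul_inv, le_div_iff₀ (by positivity)]
      exact_mod_cast hR') h
  rw [acceptProb_verifier inst 𝒪 δ D D' a b x hM, le_div_iff₀ (by positivity)]
  -- The estimates count large actions; acceptance is the complementary event.
  have h₃ (t : ℕ) : (avg M fun e => avg (2 * M) fun o =>
      if b * (𝒪.action (inst x) (randomWeights (inst x).n (blockLength δ (inst x)) e) o t).card <
        a * (inst x).n then (1 : ℝ) else 0) = 1 - avg M fun e => avg (2 * M) fun o =>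
      if b * (𝒪.action (inst x) (randomWeights (inst x).n (blockLength δ (inst x)) e) o t).card <
        a * (inst x).n then 0 else 1 := by
    rw [eq_sub_iff_add_eq, ← avg_add]
    simp only [← avg_add]
    refine (avg_congr fun e _ => (avg_congr fun o _ => ?_).trans (avg_const _ 1)).trans
      (avg_const _ 1)
    split_ifs <;> norm_num
  simp only [h₃, Finset.sum_sub_distrib, Finset.sum_const, Finset.card_range, nsmul_eq_mul, mul_one]
  push_cast at h' ⊢
  linarith

/-! ### Assembling the reduction -/

/-- A vanishing regret algorithm decides the gap problem, and thus every problem which reduces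
to it, in randomized polynomial time. -/
theorem inRP_of_reducesTo_gap {𝒪 : OnlineAlgorithm} {P : CardMinProblem} {A B α : ℝ} (hA : 0 ≤ A)
    (hAB : A < B) (hB : B ≤ 1) (hα : 0 < A → α < B / A) (h𝒪 : 𝒪.IsPolyTimeVanishing P α)
    {L : Language Bool} (hL : (PromiseProblem.ofLanguage L).ReducesTo (P.gap A B)) :
    (PromiseProblem.ofLanguage L).InRP := by
  obtain ⟨f, hf, hyes, hno⟩ := hL
  have hinst (x : List Bool) : ∃ I, P.IsInstance I ∧ I.encode = f x := by
    by_cases hx : x ∈ L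
    · obtain ⟨I, h₁, h₂, -⟩ := hyes x hx
      exact ⟨I, h₁, h₂⟩
    · obtain ⟨I, h₁, h₂, -⟩ := hno x hx
      exact ⟨I, h₁, h₂⟩
  choose inst hI hIf using hinst
  have hinst : PolyMap (id : List Bool → List Bool) fun x => (inst x).encode := by
    simp only [hIf]
    exact polyMap_of_polyTime (eb := id) hf
  have hαA : max α 0 * A < B := by
    rcases hA.eq_or_lt with rfl | hA'
    · simpa using hAB
    · rw [← lt_div_iff₀ hA']
      exact max_lt (hα hA') (div_pos (hA'.trans hAB) hA')
  -- A rational threshold lets the verifier compare cardinalities in integers, while `A`, `B` and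
  -- `α` may be arbitrary reals. The strict inequality on the left gives `γ < 1`.
  obtain ⟨q, hq, hqB⟩ := exists_rat_btwn hαA
  have hq₀ : (0 : ℝ) < q := (by positivity : 0 ≤ max α 0 * A).trans_lt hq
  have hq₀' : 0 < q.num := Rat.num_pos.2 (by exact_mod_cast hq₀)
  obtain ⟨a, ha⟩ := Int.eq_ofNat_of_zero_le hq₀'.le
  have hqab : (q : ℝ) = a / q.den := by
    conv_lhs => rw [← Rat.num_div_den q, ha]
    push_cast
    rfl
  have hb : (0 : ℝ) < q.den := by exact_mod_cast q.pos
  have hab : a ≤ q.den := by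
    have : (q : ℝ) ≤ 1 := hqB.le.trans hB
    rw [hqab, div_le_one hb] at this
    exact_mod_cast this
  set γ : ℝ := max α 0 * A / q with hγ_def
  have hγ : γ < 1 := (div_lt_one hq₀).2 hq
  have hγ₀ : 0 ≤ γ := by positivity
  -- With `η = (1 / 2) ^ δ` below half the gap `1 - γ`, `(1 + η) * γ ≤ γ + (1 - γ) / 2 = (1 + γ) /
  -- 2`.
  obtain ⟨δ, hδ⟩ := exists_pow_lt_of_lt_one (by linarith : 0 < (1 - γ) / 2)
    (by norm_num : (1 / 2 : ℝ) < 1)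
  obtain ⟨p, c, -, hc, hregret⟩ := h𝒪.regret
  obtain ⟨D, D', hD⟩ := exists_rounds p hc δ
    (by have : 0 < 1 - γ := by linarith
        positivity : 0 < (q : ℝ) * (1 - γ) / 4)
  obtain ⟨r, hr⟩ := exists_coins 𝒪 δ D D'
  obtain ⟨s, hs⟩ := hinst.exists_length_le
  have hr' (x : List Bool) : r.eval (inst x).size ≤ (r.comp s).eval x.length := by
    rw [Polynomial.eval_comp]
    exact eval_mono _ (hs x)
  refine inRP_of_acceptProb (polyTime_verifier hinst h𝒪.polyTime δ D D' a q.den)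
    (2 * (2 * r.comp s)) (by linarith : 0 < (1 - γ) / 4) (fun x hx => ?_) fun x hx => ?_
  · obtain ⟨I, -, hIx, hgap, hlt⟩ := hyes x hx
    obtain rfl : I = inst x := CardInstance.encode_injective (hIx.trans (hIf x).symm)
    replace hgap := hgap.resolve_right hlt.not_ge
    -- An empty ground set cannot give a yes-instance, since `|x_opt| < B * n` is strict.
    have hn : 0 < (inst x).n := by
      refine Nat.pos_of_ne_zero fun h => ?_
      rw [h, Nat.cast_zero, mul_zero] at hlt
      exact hlt.not_ge (Nat.cast_nonneg _)
    obtain ⟨y, hy, hy'⟩ := Nat.sInf_mem (Set.Nonempty.image Finset.card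
      (P.exists_feasible _ (hI x) : {y | P.Feasible (inst x) y}.Nonempty))
    simp only [Polynomial.eval_mul, Polynomial.eval_ofNat]
    refine le_acceptProb_verifier (R := (p.eval (inst x).size : ℕ) *
      ((2 ^ roundBits D D' (inst x) : ℕ) : ℝ) ^ c) ((hr _).1.trans (hr' x))
      ((hr _).2.1.trans (hr' x)) (fun e => ((hr _).2.2 e).trans (hr' x)) (by omega) hab hn hγ
      (by nlinarith) (fun w hw => hregret _ (hI x) w hw _) (by positivity) ?_ hy ?_
    · rw [← hqab, ← mul_assoc]
      exact hD _ _ (Nat.lt_size_self _).le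
    · rw [← hqab, ← mul_assoc, hγ_def, div_mul_cancel₀ _ hq₀.ne', mul_assoc]
      refine mul_le_mul_of_nonneg_left (le_trans (le_of_eq ?_) hgap) (le_max_right _ _)
      exact_mod_cast hy'
  · obtain ⟨I, -, hIx, -, hge⟩ := hno x hx
    obtain rfl : I = inst x := CardInstance.encode_injective (hIx.trans (hIf x).symm)
    simp only [Polynomial.eval_mul, Polynomial.eval_ofNat]
    refine acceptProb_verifier_eq_zero ((hr _).1.trans (hr' x))
      (fun e => ((hr _).2.2 e).trans (hr' x)) (h𝒪.feasible _ (hI x)) fun y hy => ?_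
    have h₁ : (P.opt (inst x) : ℝ) ≤ y.card := by
      exact_mod_cast Nat.sInf_le (Set.mem_image_of_mem _ hy)
    have h₂ : (q : ℝ) * (inst x).n ≤ y.card :=
      (mul_le_mul_of_nonneg_right hqB.le (Nat.cast_nonneg _)).trans ((not_lt.1 hge).trans h₁)
    rw [hqab, div_mul_eq_mul_div, div_le_iff₀ hb, mul_comm (y.card : ℝ)] at h₂
    exact_mod_cast h₂

end StackProgram

/-- For a cardinality minimization problem `P` whose gap problem `[A,B]-Gap-P` is NP-complete, and
every `α < B / A` (every `α`, if `A = 0`), online min-max-`P` has no randomized polynomial-time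
vanishing `α`-regret algorithm unless NP = RP. -/
theorem theorem1 (P : CardMinProblem) (A B : ℝ) (hA : 0 ≤ A) (hAB : A < B) (hB : B ≤ 1)
    (hgap : (P.gap A B).NPComplete) (α : ℝ) (hα : 0 < A → α < B / A)
    (hNPRP : classNP ≠ classRP) :
    ¬ ∃ 𝒪 : OnlineAlgorithm, 𝒪.IsPolyTimeVanishing P α := by
  rintro ⟨𝒪, h𝒪⟩
  exact hNPRP (Set.Subset.antisymm (fun L hL => StackProgram.inRP_of_reducesTo_gap hA hAB hB hα h𝒪
    (hgap.2 L hL)) StackProgram.classRP_subset_classNP)
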